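/- Let $D$ be a finite digraph without loops and without multiple arcs, with vertices $v_1,\dots,v_n$ and $a$ arcs. For each $i$ let $N_i$ be the set of vertices $v_j$ such that both $(v_i,v_j)$ and $(v_j,v_i)$ are arcs of $D$, let $c_2^{(i)}=|N_i|$ (the number of closed walks of length $2$ starting at $v_i$), and let $t_2^{(i)}=\sum_{v_j\in N_i}c_2^{(j)}$. Put $$q=\frac{\sum_{i=1}^n \bigl(t_2^{(i)}\bigr)^2}{\sum_{i=1}^n \bigl(c_2^{(i)}\bigr)^2},$$ with the convention $q=0$ if all $c_2^{(i)}$ are $0$. Let $z_1,\dots,z_n$ be the eigenvalues, with multiplicity, of the adjacency matrix of $D$, and let $E(D)=\sum_{i=1}^n|\mathrm{Re}(z_i)|$ be the energy of $D$. Then $q\le a$ and $$E(D)\le \sqrt{q}+\sqrt{(n-1)(a-q)}.$$ Equality holds in the last inequality if and only if $D$ is the symmetric digraph of a simple graph $G$ (obtained from $G$ by replacing every edge $uv$ by the two arcs $(u,v)$ and $(v,u)$), where $G$ is one of the following: $\frac n2K_2$ (with $n$ even), $K_n$, $nK_1$, or a non-complete connected strongly regular graph that has exactly two distinct eigenvalues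 different from its degree (the non-trivial eigenvalues), both of absolute value $\sqrt{\frac{a-q}{n-1}}$. -/

import Mathlib

noncomputable section

namespace Digraph

variable {V : Type*}

/-- The adjacency matrix of a digraph, a `0-1` matrix, with complex entries. -/
def adjacencyMatrix (D : Digraph V) : Matrix V V ℂ :=
  open Classical in Matrix.of fun u v => if D.Adj u v then 1 else 0

variable [Fintype V]

/-- The number of arcs of a digraph. -/
def numArcs (D : Digraph V) : ℕ :=
  open Classical in (Finset.univ.filter fun p : V × V => D.Adj p.1 p.2).card

/-- The eigenvalues of a digraph: the roots of the characteristic polynomial of its adjacency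
matrix, with multiplicity. -/
def eigenvalues (D : Digraph V) : Multiset ℂ :=
  open Classical in D.adjacencyMatrix.charpoly.roots

/-- The energy of a digraph: the sum of `|Re z|` over the eigenvalues `z`, with multiplicity. -/
def energy (D : Digraph V) : ℝ :=
  (D.eigenvalues.map fun z => |z.re|).sum

/-- The vertices doubly adjacent to `v`. -/
def doublyAdjacent (D : Digraph V) (v : V) : Finset V :=
  open Classical in Finset.univ.filter fun w => D.Adj v w ∧ D.Adj w v

/-- The number of closed walks of length `2` starting at `v`; such a walk `v, w, v` is determined
by its midpoint `w`, a vertex doubly adjacent to `v`. -/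
def closedTwoWalks (D : Digraph V) (v : V) : ℕ :=
  (D.doublyAdjacent v).card

/-- The sum of the numbers of closed walks of length `2` over the vertices doubly adjacent
to `v`. -/
def twoWalkSum (D : Digraph V) (v : V) : ℕ :=
  ∑ w ∈ D.doublyAdjacent v, D.closedTwoWalks w

/-- The quotient `∑ (t₂⁽ᵛ⁾)² / ∑ (c₂⁽ᵛ⁾)²`; it is `0` when there are no closed walks of
length `2`. -/
def walkQuotient (D : Digraph V) : ℝ :=
  (∑ v, (D.twoWalkSum v : ℝ) ^ 2) / ∑ v, (D.closedTwoWalks v : ℝ) ^ 2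

end Digraph

namespace SimpleGraph

variable {V : Type*}

/-- The symmetric digraph of a simple graph: each edge becomes a pair of opposite arcs. -/
def symmetricDigraph (G : SimpleGraph V) : Digraph V where
  Adj := G.Adj

/-- The disjoint union of copies of `H`, indexed by `ι`. -/
def disjointCopies (ι : Type*) {W : Type*} (H : SimpleGraph W) : SimpleGraph (ι × W) where
  Adj p q := p.1 = q.1 ∧ H.Adj p.2 q.2
  symm := ⟨fun _ _ h => ⟨h.1.symm, h.2.symm⟩⟩
  loopless := ⟨fun p h => H.irrefl h.2⟩

/-- `G` is `(n/2) K₂` with `n` the number of vertices of `G` (which is then even). -/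
def IsHalfCopiesK2 (G : SimpleGraph V) : Prop :=
  ∃ m : ℕ, Nonempty (G ≃g disjointCopies (Fin m) (completeGraph (Fin 2)))

/-- `G` is a non-complete connected strongly regular graph with exactly two non-trivial
eigenvalues (eigenvalues of its adjacency matrix other than its degree), both of absolute
value `θ`. -/
def IsConnectedSRGWithNontrivialAbs [Fintype V] (G : SimpleGraph V) (θ : ℝ) : Prop :=
  open Classical in
  G ≠ ⊤ ∧ G.Connected ∧ ∃ k ℓ m : ℕ, G.IsSRGWith (Fintype.card V) k ℓ m ∧
    ∃ μ ν : ℝ, μ ≠ ν ∧ spectrum ℝ (G.adjMatrix ℝ) \ {(k : ℝ)} = {μ, ν} ∧ |μ| = θ ∧ |ν| = θ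

end SimpleGraph

end

/-! Let `A` be the adjacency matrix, `M = (A + Aᵀ)/2`, `c` and `t` the vectors of the `c₂` and `t₂`,
and `C = ∑ c`. In a Schur form of `A` the real parts of the eigenvalues are averages of the
eigenvalues `λ` of `M` with doubly stochastic weights, so `E ≤ ∑ |λ|`
(`sum_abs_re_roots_charpoly_le`). Here `∑ λ² = b := (a + C)/2 ≤ a`. Since `M` dominates entrywise
the 0-1 matrix of double adjacency, `‖M c‖² ≥ ‖t‖² = q ‖c‖²`, so some `ρ = |λ|` is at least `√q`.
Cauchy-Schwarz bounds the sum by `ρ + √((n-1)(b-ρ²))`, which decreases for `ρ ≥ √(b/n)`. If `b ≤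
nq`, then `ρ` may be lowered to `√q` and `b` raised to `a`. Otherwise `∑ |λ| ≤ √(nb)`, and `C ≤ n√q`
makes `a = 2b - C` large enough (`add_le_add_sqrt`).

When there are arcs, equality forces `C = a`, so `D` comes from a graph and `M = A`. It also forces
`A²` to have eigenvalue `q` once and `r = (a-q)/(n-1)` otherwise, whence `A² = r I + β c cᵀ` with `β
≥ 0`. If `β = 0`, the graph is a perfect matching. If `β > 0`, commutation of `A` with `A²` makes
the graph regular (`regular_of_mul_self_eq`), so `A² = r I + μ J` and the graph is complete or
strongly regular with eigenvalues `±√r` besides the degree.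

Conversely, constant row sums `k` and `A² = θ² I + μ J` give `|A| = θ I + ((k-θ)/n) J`, and its
trace is the bound. -/

namespace Matrix

/-! ### Schur triangulation and the trace norm of the symmetric part -/

open Polynomial

/-- A weak form of Schur triangulation: the diagonal of a suitable unitary conjugate lists the
roots of the characteristic polynomial. -/
def HasSchurDiagonal {ι : Type*} [Fintype ι] [DecidableEq ι] (A : Matrix ι ι ℂ) : Prop :=
  ∃ U : Matrix ι ι ℂ, star U * U = 1 ∧ A.charpoly = ∏ i, (X - C ((star U * A * U) i i))

theorem HasSchurDiagonal.reindex {ι κ : Type*} [Fintype ι] [DecidableEq ι] [Fintype κ]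
    [DecidableEq κ] (e : ι ≃ κ) {A : Matrix ι ι ℂ} (h : A.HasSchurDiagonal) :
    (Matrix.reindex e e A).HasSchurDiagonal := by
  obtain ⟨U, hU, hA⟩ := h
  refine ⟨Matrix.reindex e e U, ?_, ?_⟩
  · simp only [reindex_apply, star_eq_conjTranspose, conjTranspose_submatrix,
      submatrix_mul_equiv] at hU ⊢
    rw [hU, submatrix_one_equiv]
  · rw [charpoly_reindex, hA]
    simp only [reindex_apply, star_eq_conjTranspose, conjTranspose_submatrix,
      submatrix_mul_equiv, submatrix_apply]
    exact (Equiv.prod_comp e.symm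
      (fun i => (X - C ((Uᴴ * A * U) i i) : ℂ[X]))).symm

theorem HasSchurDiagonal.of_conj {ι : Type*} [Fintype ι] [DecidableEq ι]
    {A W : Matrix ι ι ℂ} (hW : star W * W = 1) (h : (star W * A * W).HasSchurDiagonal) :
    A.HasSchurDiagonal := by
  obtain ⟨U, hU, hA⟩ := h
  refine ⟨W * U, ?_, ?_⟩
  · rw [star_mul, Matrix.mul_assoc, ← Matrix.mul_assoc (star W), hW, Matrix.one_mul, hU]
  · have : (star W * A * W).charpoly = A.charpoly := by
      rw [charpoly_mul_comm, ← Matrix.mul_assoc, mul_eq_one_comm.mp hW, Matrix.one_mul]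
    rw [← this, hA]
    simp only [star_mul, Matrix.mul_assoc]

theorem HasSchurDiagonal.fromBlocks {ι : Type*} [Fintype ι] [DecidableEq ι]
    (a : Matrix Unit Unit ℂ) (r : Matrix Unit ι ℂ) {B : Matrix ι ι ℂ} (h : B.HasSchurDiagonal) :
    (Matrix.fromBlocks a r 0 B).HasSchurDiagonal := by
  obtain ⟨U, hU, hB⟩ := h
  refine ⟨Matrix.fromBlocks 1 0 0 U, ?_, ?_⟩
  · simp only [star_eq_conjTranspose] at hU
    simp [star_eq_conjTranspose, fromBlocks_conjTranspose, fromBlocks_multiply, hU]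
  · rw [charpoly_fromBlocks_zero₂₁, hB, Fintype.prod_sum_type]
    congr 1
    · simp [star_eq_conjTranspose, fromBlocks_conjTranspose, fromBlocks_multiply, charpoly,
        charmatrix, det_unique]
    · simp [star_eq_conjTranspose, fromBlocks_conjTranspose, fromBlocks_multiply]

/-- A complex matrix is unitarily similar to one whose first column is zero off the diagonal. -/
theorem exists_unitary_conj_eq_fromBlocks {n : ℕ} (A : Matrix (Unit ⊕ Fin n) (Unit ⊕ Fin n) ℂ) :
    ∃ W : Matrix (Unit ⊕ Fin n) (Unit ⊕ Fin n) ℂ, star W * W = 1 ∧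
      (star W * A * W).toBlocks₂₁ = 0 := by
  obtain ⟨z, hz⟩ := Module.End.exists_eigenvalue (Matrix.toLin' A)
  obtain ⟨x, hx⟩ := hz.exists_hasEigenvector
  have hxe : A *ᵥ x = z • x := by simpa using hx.apply_eq_smul
  have hx0 : (WithLp.toLp 2 x : EuclideanSpace ℂ (Unit ⊕ Fin n)) ≠ 0 := by
    intro h
    apply hx.2
    simpa using h
  set y : EuclideanSpace ℂ (Unit ⊕ Fin n) := WithLp.toLp 2 x with hy
  have hunit : ‖((‖y‖ : ℂ)⁻¹) • y‖ = 1 := by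
    rw [norm_smul]
    simp [hx0]
  -- A normalized eigenvector is completed to an orthonormal basis, whose members become the columns
  -- of `W`.
  obtain ⟨b, hb⟩ := Orthonormal.exists_orthonormalBasis_extension_of_card_eq
    (𝕜 := ℂ) (E := EuclideanSpace ℂ (Unit ⊕ Fin n)) (ι := Unit ⊕ Fin n) (by simp)
    (v := fun _ => ((‖y‖ : ℂ)⁻¹) • y) (s := {Sum.inl ()})
    (by
      refine ⟨fun i => hunit, ?_⟩
      intro i j hij
      exact (hij (Subsingleton.elim _ _)).elim)
  have hb0 : b (Sum.inl ()) = ((‖y‖ : ℂ)⁻¹) • y := hb _ rfl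
  have hWW : star (Matrix.of fun i j => b j i) * (Matrix.of fun i j => b j i) =
      (1 : Matrix (Unit ⊕ Fin n) (Unit ⊕ Fin n) ℂ) := by
    ext i j
    have := orthonormal_iff_ite.mp b.orthonormal i j
    rw [Matrix.one_apply, ← this, Matrix.mul_apply]
    simp [PiLp.inner_apply, Matrix.star_apply, mul_comm]
  refine ⟨Matrix.of fun i j => b j i, hWW, ?_⟩
  set W : Matrix (Unit ⊕ Fin n) (Unit ⊕ Fin n) ℂ := Matrix.of fun i j => b j i with hW
  have hcol : ∀ i, (A * W) i (Sum.inl ()) = z * W i (Sum.inl ()) := by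
    intro i
    have h1 : ∀ k, W k (Sum.inl ()) = (‖y‖ : ℂ)⁻¹ * x k := by
      intro k; simp [hW, hb0, hy]
    have h2 := congrFun hxe i
    simp only [Matrix.mulVec, dotProduct, Pi.smul_apply, smul_eq_mul] at h2
    rw [Matrix.mul_apply, h1]
    simp only [h1]
    rw [mul_left_comm, ← h2, Finset.mul_sum]
    exact Finset.sum_congr rfl fun k _ => by ring
  ext i j
  have h3 : (star W * A * W) (Sum.inr i) (Sum.inl ()) =
      z * (star W * W) (Sum.inr i) (Sum.inl ()) := by
    rw [Matrix.mul_assoc, Matrix.mul_apply, Matrix.mul_apply, Finset.mul_sum]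
    exact Finset.sum_congr rfl fun k _ => by rw [hcol]; ring
  simpa [Matrix.toBlocks₂₁, hWW] using h3

/-- Deflation by induction on the size: once an eigenvector is split off, the block triangular form
reduces the claim to the lower right block. -/
theorem hasSchurDiagonal_fin : ∀ (n : ℕ) (A : Matrix (Fin n) (Fin n) ℂ), A.HasSchurDiagonal
  | 0, A => ⟨1, by simp, by simp [charpoly, det_isEmpty]⟩
  | n + 1, A => by
    let e : Fin (n + 1) ≃ Unit ⊕ Fin n := Fintype.equivOfCardEq (by simp [add_comm])
    obtain ⟨W, hW, h0⟩ := exists_unitary_conj_eq_fromBlocks (Matrix.reindex e e A)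
    have h1 : (Matrix.reindex e e A).HasSchurDiagonal := by
      refine .of_conj hW ?_
      rw [← fromBlocks_toBlocks (star W * Matrix.reindex e e A * W), h0]
      exact .fromBlocks _ _ (hasSchurDiagonal_fin n _)
    simpa using h1.reindex e.symm

theorem hasSchurDiagonal {ι : Type*} [Fintype ι] [DecidableEq ι] (A : Matrix ι ι ℂ) :
    A.HasSchurDiagonal := by
  let e := Fintype.equivFin ι
  simpa using (hasSchurDiagonal_fin _ (Matrix.reindex e e A)).reindex e.symm

/-- Orthogonal diagonalization of a real symmetric matrix. -/
theorem IsHermitian.exists_orthogonal_diagonalization {ι : Type*} [Fintype ι] [DecidableEq ι]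
    {M : Matrix ι ι ℝ} (hM : M.IsHermitian) :
    ∃ O : Matrix ι ι ℝ, Oᵀ * O = 1 ∧ M = O * diagonal hM.eigenvalues * Oᵀ := by
  refine ⟨hM.eigenvectorUnitary, ?_, ?_⟩
  · simpa [star_eq_conjTranspose, conjTranspose_eq_transpose_of_trivial] using
      Unitary.coe_star_mul_self hM.eigenvectorUnitary
  · conv_lhs => rw [hM.spectral_theorem]
    rw [Unitary.conjStarAlgAut_apply, star_eq_conjTranspose,
      conjTranspose_eq_transpose_of_trivial]
    rfl

/-- The sum of the absolute values of the real parts of the eigenvalues of a real matrix is at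
most the trace norm of its symmetric part. -/
theorem sum_abs_re_roots_charpoly_le {ι : Type*} [Fintype ι] [DecidableEq ι]
    (B M : Matrix ι ι ℝ) (hM : M.IsHermitian) (hBM : B + Bᵀ = (2 : ℝ) • M) :
    (((B.map Complex.ofReal).charpoly.roots).map fun z => |z.re|).sum ≤
      ∑ k, |hM.eigenvalues k| := by
  obtain ⟨U, hU, hch⟩ := hasSchurDiagonal (B.map Complex.ofReal)
  obtain ⟨O, hO, hMO⟩ := hM.exists_orthogonal_diagonalization
  have hroots : (B.map Complex.ofReal).charpoly.roots =
      Finset.univ.val.map fun i => (star U * B.map Complex.ofReal * U) i i := by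
    rw [hch, ← roots_multiset_prod_X_sub_C (Finset.univ.val.map _), Multiset.map_map]
    rfl
  have hsum : (((B.map Complex.ofReal).charpoly.roots).map fun z => |z.re|).sum =
      ∑ i, |((star U * B.map Complex.ofReal * U) i i).re| := by
    rw [hroots, Multiset.map_map]
    rfl
  rw [hsum]
  set P : Matrix ι ι ℂ := O.map Complex.ofReal with hP
  have hPstar : star P = Oᵀ.map Complex.ofReal := by
    ext i j
    simp [hP, Matrix.star_apply]
  have hPP : P * star P = 1 := by
    have h1 := congrArg (fun X : Matrix ι ι ℝ => X.map Complex.ofRealHom) (mul_eq_one_comm.mp hO)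
    simp only [Matrix.map_mul] at h1
    rw [hPstar]
    exact h1.trans (by simp)
  set W : Matrix ι ι ℂ := star P * U with hWdef
  have hW : W * star W = 1 := by
    have h1 : star W * W = 1 := by
      rw [hWdef, star_mul, star_star, Matrix.mul_assoc, ← Matrix.mul_assoc P, hPP,
        Matrix.one_mul, hU]
    exact mul_eq_one_comm.mp h1
  have hdiag : M.map Complex.ofReal =
      P * diagonal (fun k => (hM.eigenvalues k : ℂ)) * star P := by
    conv_lhs => rw [hMO]
    rw [hPstar, hP]
    ext i j
    simp [Matrix.mul_apply, Matrix.diagonal_apply]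
  have hconj : star U * B.map Complex.ofReal * U + star (star U * B.map Complex.ofReal * U) =
      (2 : ℂ) • (star W * diagonal (fun k => (hM.eigenvalues k : ℂ)) * W) := by
    have h1 : B.map Complex.ofReal + star (B.map Complex.ofReal) =
        (2 : ℂ) • M.map Complex.ofReal := by
      ext i j
      have := congrFun (congrFun hBM i) j
      simp only [Matrix.add_apply, Matrix.transpose_apply, Matrix.smul_apply, smul_eq_mul] at this
      simp only [Matrix.add_apply, Matrix.map_apply, Matrix.star_apply, Matrix.smul_apply,
        smul_eq_mul, RCLike.star_def, Complex.conj_ofReal]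
      exact_mod_cast this
    calc _ = star U * (B.map Complex.ofReal + star (B.map Complex.ofReal)) * U := by
          simp only [star_mul, star_star, Matrix.mul_add, Matrix.add_mul, Matrix.mul_assoc]
      _ = _ := by
          rw [h1, hdiag, hWdef]
          simp only [star_mul, star_star, Matrix.mul_assoc, Matrix.smul_mul, Matrix.mul_smul]
  -- The diagonal entries of `W* diag(λ) W` are combinations of the `λ k` with weights `|W k i|²`.
  have hre : ∀ i, ((star U * B.map Complex.ofReal * U) i i).re =
      ∑ k, hM.eigenvalues k * Complex.normSq (W k i) := by
    intro i
    have h3 : (star W * diagonal (fun k => (hM.eigenvalues k : ℂ)) * W) i i =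
        ((∑ k, hM.eigenvalues k * Complex.normSq (W k i) : ℝ) : ℂ) := by
      rw [Matrix.mul_apply, Complex.ofReal_sum]
      refine Finset.sum_congr rfl fun k _ => ?_
      rw [Matrix.mul_diagonal, Matrix.star_apply, RCLike.star_def, Complex.ofReal_mul,
        ← Complex.mul_conj]
      ring
    have h1 := congrArg Complex.re (congrFun (congrFun hconj i) i)
    rw [Matrix.add_apply, Matrix.star_apply, Complex.add_re, RCLike.star_def, Complex.conj_re,
      Matrix.smul_apply, h3, smul_eq_mul, ← Complex.ofReal_ofNat, Complex.re_ofReal_mul,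
      Complex.ofReal_re] at h1
    linarith
  -- Rows of `W` are unit vectors, so each `|λ k|` is counted with total weight one.
  have hrow : ∀ k, ∑ i, Complex.normSq (W k i) = 1 := by
    intro k
    have h1 := congrFun (congrFun hW k) k
    rw [Matrix.mul_apply, Matrix.one_apply_eq] at h1
    simp only [Matrix.star_apply, RCLike.star_def, Complex.mul_conj] at h1
    exact_mod_cast h1
  calc ∑ i, |((star U * B.map Complex.ofReal * U) i i).re|
      ≤ ∑ i, ∑ k, |hM.eigenvalues k| * Complex.normSq (W k i) := by
        refine Finset.sum_le_sum fun i _ => ?_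
        rw [hre]
        refine (Finset.abs_sum_le_sum_abs _ _).trans (Finset.sum_le_sum fun k _ => ?_)
        rw [abs_mul, abs_of_nonneg (Complex.normSq_nonneg _)]
    _ = ∑ k, |hM.eigenvalues k| := by
        rw [Finset.sum_comm]
        refine Finset.sum_congr rfl fun k _ => ?_
        rw [← Finset.mul_sum, hrow, mul_one]

end Matrix

/-! ### Spectral identities and Cauchy-Schwarz for real symmetric matrices -/

namespace Matrix

variable {ι : Type*} [Fintype ι] [DecidableEq ι] {M : Matrix ι ι ℝ}

theorem IsHermitian.mul_self_apply (hM : M.IsHermitian) {O : Matrix ι ι ℝ} (hO : Oᵀ * O = 1)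
    (hMO : M = O * diagonal hM.eigenvalues * Oᵀ) (i j : ι) :
    (M * M) i j = ∑ k, hM.eigenvalues k ^ 2 * (O i k * O j k) := by
  have h : M * M = O * diagonal (fun k => hM.eigenvalues k ^ 2) * Oᵀ := by
    conv_lhs => rw [hMO]
    rw [Matrix.mul_assoc (O * _), Matrix.mul_assoc O _ Oᵀ, ← Matrix.mul_assoc Oᵀ, hO,
      Matrix.one_mul, Matrix.mul_assoc O, ← Matrix.mul_assoc (diagonal _),
      diagonal_mul_diagonal, ← Matrix.mul_assoc]
    simp only [sq]
  rw [h, Matrix.mul_apply]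
  simp only [mul_diagonal, transpose_apply]
  exact Finset.sum_congr rfl fun k _ => by ring

/-- Both sides are the trace of `M * M`. -/
theorem IsHermitian.sum_sq_eigenvalues (hM : M.IsHermitian) :
    ∑ k, hM.eigenvalues k ^ 2 = ∑ i, ∑ j, M i j ^ 2 := by
  obtain ⟨O, hO, hMO⟩ := hM.exists_orthogonal_diagonalization
  have hcol : ∀ k, ∑ i, O i k * O i k = 1 := by
    intro k
    simpa [Matrix.mul_apply] using congrFun (congrFun hO k) k
  have h1 : ∀ i, ∑ j, M i j ^ 2 = (M * M) i i := by
    intro i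
    rw [Matrix.mul_apply]
    refine Finset.sum_congr rfl fun j _ => ?_
    rw [sq, ← hM.apply j i]
    simp
  simp only [h1, hM.mul_self_apply hO hMO]
  rw [Finset.sum_comm]
  simp only [← Finset.mul_sum, hcol, mul_one]

theorem IsHermitian.sum_sq_mulVec (hM : M.IsHermitian) {O : Matrix ι ι ℝ} (hO : Oᵀ * O = 1)
    (hMO : M = O * diagonal hM.eigenvalues * Oᵀ) (x : ι → ℝ) :
    ∑ i, (M *ᵥ x) i ^ 2 = ∑ k, hM.eigenvalues k ^ 2 * (Oᵀ *ᵥ x) k ^ 2 := by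
  have hn : ∀ y : ι → ℝ, ∑ i, y i ^ 2 = y ⬝ᵥ y := fun y => by simp [dotProduct, sq]
  have h2 : M *ᵥ x = O *ᵥ (diagonal hM.eigenvalues *ᵥ (Oᵀ *ᵥ x)) := by
    conv_lhs => rw [hMO]
    simp only [mulVec_mulVec, Matrix.mul_assoc]
  rw [hn, h2, dotProduct_mulVec, ← mulVec_transpose, mulVec_mulVec, hO, one_mulVec]
  simp only [dotProduct, mulVec_diagonal]
  exact Finset.sum_congr rfl fun k _ => by ring

theorem sum_sq_transpose_mulVec {O : Matrix ι ι ℝ} (hO : Oᵀ * O = 1) (x : ι → ℝ) :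
    ∑ k, (Oᵀ *ᵥ x) k ^ 2 = ∑ i, x i ^ 2 := by
  have hn : ∀ y : ι → ℝ, ∑ i, y i ^ 2 = y ⬝ᵥ y := fun y => by simp [dotProduct, sq]
  rw [hn, hn, dotProduct_mulVec, ← mulVec_transpose, mulVec_mulVec, transpose_transpose,
    mul_eq_one_comm.mp hO, one_mulVec]

/-- If `M` stretches some vector by a factor at least `√q`, it has an eigenvalue of absolute value
at least `√q`. -/
theorem IsHermitian.exists_le_sq_eigenvalues (hM : M.IsHermitian) {q : ℝ} {x : ι → ℝ} (hx : x ≠ 0)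
    (h : q * ∑ i, x i ^ 2 ≤ ∑ i, (M *ᵥ x) i ^ 2) : ∃ k, q ≤ hM.eigenvalues k ^ 2 := by
  obtain ⟨O, hO, hMO⟩ := hM.exists_orthogonal_diagonalization
  by_contra! hlt
  rw [hM.sum_sq_mulVec hO hMO, ← sum_sq_transpose_mulVec hO x, Finset.mul_sum] at h
  have hpos : 0 < ∑ k, (Oᵀ *ᵥ x) k ^ 2 := by
    rw [sum_sq_transpose_mulVec hO x]
    obtain ⟨i, hi⟩ := Function.ne_iff.mp hx
    exact Finset.sum_pos' (fun _ _ => sq_nonneg _) ⟨i, Finset.mem_univ _, by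
      have : x i ≠ 0 := hi
      positivity⟩
  obtain ⟨k, _, hk⟩ := Finset.exists_ne_zero_of_sum_ne_zero hpos.ne'
  refine absurd h (not_le.mpr (Finset.sum_lt_sum
    (fun j _ => mul_le_mul_of_nonneg_right (hlt j).le (sq_nonneg _))
    ⟨k, Finset.mem_univ _, mul_lt_mul_of_pos_right (hlt k) (lt_of_le_of_ne (sq_nonneg _) hk.symm)⟩))

/-- If the squares of the eigenvalues are `p` once and `r` otherwise, and `x` is stretched by `√p`,
then `M ^ 2` is a scalar matrix plus a multiple of `x xᵀ`. -/
theorem IsHermitian.mul_self_eq_of_sq_eigenvalues (hM : M.IsHermitian) {p r : ℝ} {k₀ : ι}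
    (h0 : hM.eigenvalues k₀ ^ 2 = p) (hr : ∀ k, k ≠ k₀ → hM.eigenvalues k ^ 2 = r)
    {x : ι → ℝ} (hx : x ≠ 0) (h : ∑ i, (M *ᵥ x) i ^ 2 = p * ∑ i, x i ^ 2) (i j : ι) :
    (M * M) i j = (if i = j then r else 0) + (p - r) / (∑ i, x i ^ 2) * (x i * x j) := by
  obtain ⟨O, hO, hMO⟩ := hM.exists_orthogonal_diagonalization
  have hsplit : ∀ f : ι → ℝ, ∑ k, hM.eigenvalues k ^ 2 * f k = r * ∑ k, f k + (p - r) * f k₀ := by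
    intro f
    rw [← Finset.add_sum_erase _ _ (Finset.mem_univ k₀),
      ← Finset.add_sum_erase _ f (Finset.mem_univ k₀), h0,
      Finset.sum_congr rfl fun k hk => by rw [hr k (Finset.ne_of_mem_erase hk)],
      ← Finset.mul_sum]
    ring
  have hMM : (M * M) i j = (if i = j then r else 0) + (p - r) * (O i k₀ * O j k₀) := by
    rw [hM.mul_self_apply hO hMO, hsplit]
    congr 1
    have hO' : O * Oᵀ = 1 := mul_eq_one_comm.mp hO
    have := congrFun (congrFun hO' i) j
    rw [Matrix.mul_apply, Matrix.one_apply] at this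
    simp only [transpose_apply] at this
    rw [this]
    split_ifs <;> simp
  have hpos : 0 < ∑ i, x i ^ 2 := by
    obtain ⟨i, hi⟩ := Function.ne_iff.mp hx
    exact Finset.sum_pos' (fun _ _ => sq_nonneg _) ⟨i, Finset.mem_univ _, by
      have : x i ≠ 0 := hi
      positivity⟩
  -- For `p = r` the vector `x` need not lie along column `k₀`, but the rank one term vanishes.
  by_cases hpr : p = r
  · rw [hMM, hpr]; simp
  have hsub : p - r ≠ 0 := sub_ne_zero.mpr hpr
  set α := (Oᵀ *ᵥ x) k₀ with hα
  -- With `p ≠ r`, the stretching hypothesis puts the whole norm of `x` in its `k₀` coordinate, so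
  -- `x` is a multiple of that eigenvector.
  have hαs : α ^ 2 = ∑ i, x i ^ 2 := by
    rw [hM.sum_sq_mulVec hO hMO, hsplit, sum_sq_transpose_mulVec hO] at h
    have : (p - r) * (α ^ 2 - ∑ i, x i ^ 2) = 0 := by linarith
    have := (mul_eq_zero.mp this).resolve_left hsub
    linarith
  have hαdot : α = ∑ i, O i k₀ * x i := by simp [hα, mulVec, dotProduct]
  have hcol : ∑ i, O i k₀ ^ 2 = 1 := by
    simpa [Matrix.mul_apply, sq] using congrFun (congrFun hO k₀) k₀
  have hxO : ∀ i, x i = α * O i k₀ := by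
    have hz : ∑ i, (x i - α * O i k₀) ^ 2 = 0 := by
      have : ∀ i, (x i - α * O i k₀) ^ 2 =
          x i ^ 2 - 2 * α * (O i k₀ * x i) + α ^ 2 * O i k₀ ^ 2 := fun i => by ring
      simp only [this, Finset.sum_add_distrib, Finset.sum_sub_distrib, ← Finset.mul_sum]
      rw [hcol, ← hαdot, ← hαs]
      ring
    intro i
    have := (Finset.sum_eq_zero_iff_of_nonneg fun i _ => sq_nonneg _).mp hz i (Finset.mem_univ i)
    have := pow_eq_zero_iff (two_ne_zero) |>.mp this
    linarith
  rw [hMM, ← hαs, hxO i, hxO j]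
  have : α ≠ 0 := by
    rintro h0
    rw [h0] at hαs
    simp at hαs
    linarith
  field_simp

/-- Cauchy-Schwarz for the eigenvalues other than one of them. -/
theorem sq_sum_erase_abs_le (f : ι → ℝ) (k₀ : ι) :
    (∑ k ∈ Finset.univ.erase k₀, |f k|) ^ 2 ≤
      ((Fintype.card ι : ℝ) - 1) * (∑ k, f k ^ 2 - f k₀ ^ 2) := by
  have h := sq_sum_le_card_mul_sum_sq (s := Finset.univ.erase k₀) (f := fun k => |f k|)
  rw [Finset.card_erase_of_mem (Finset.mem_univ _), Finset.card_univ,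
    Nat.cast_sub (Fintype.card_pos_iff.mpr ⟨k₀⟩), Nat.cast_one] at h
  simp only [sq_abs] at h
  rwa [← Finset.add_sum_erase _ (fun k => f k ^ 2) (Finset.mem_univ k₀), add_sub_cancel_left]

/-- Equality in Cauchy-Schwarz means that the `|f k|` with `k ≠ k₀` have zero variance about their
mean `T / N`. -/
theorem sq_eq_of_sq_sum_erase_abs_eq (hι : 1 < Fintype.card ι) (f : ι → ℝ) (k₀ : ι)
    (h : (∑ k ∈ Finset.univ.erase k₀, |f k|) ^ 2 =
      ((Fintype.card ι : ℝ) - 1) * (∑ k, f k ^ 2 - f k₀ ^ 2)) (k : ι) (hk : k ≠ k₀) :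
    f k ^ 2 = (∑ k, f k ^ 2 - f k₀ ^ 2) / ((Fintype.card ι : ℝ) - 1) := by
  have hn : (0 : ℝ) < (Fintype.card ι : ℝ) - 1 := by
    have : (1 : ℝ) < Fintype.card ι := by exact_mod_cast hι
    linarith
  set N := (Fintype.card ι : ℝ) - 1 with hN
  rw [← Finset.add_sum_erase _ (fun k => f k ^ 2) (Finset.mem_univ k₀), add_sub_cancel_left] at h ⊢
  set T := ∑ k ∈ Finset.univ.erase k₀, |f k|
  set Q := ∑ k ∈ Finset.univ.erase k₀, f k ^ 2
  have hz : ∑ k ∈ Finset.univ.erase k₀, (|f k| - T / N) ^ 2 = 0 := by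
    have h1 : ∀ k, (|f k| - T / N) ^ 2 = f k ^ 2 - 2 * (T / N) * |f k| + (T / N) ^ 2 := by
      intro k
      rw [sub_sq, sq_abs]
      ring
    simp only [h1, Finset.sum_add_distrib, Finset.sum_sub_distrib, ← Finset.mul_sum]
    rw [Finset.sum_const, Finset.card_erase_of_mem (Finset.mem_univ _), Finset.card_univ,
      nsmul_eq_mul, Nat.cast_sub hι.le, Nat.cast_one, ← hN]
    change Q - 2 * (T / N) * T + N * (T / N) ^ 2 = 0
    have hQ : Q = T ^ 2 / N := by rw [h]; field_simp
    rw [hQ]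
    field_simp
    ring
  have h2 := (Finset.sum_eq_zero_iff_of_nonneg fun i _ => sq_nonneg _).mp hz k
    (Finset.mem_erase.mpr ⟨hk, Finset.mem_univ k⟩)
  have h3 : |f k| = T / N := by
    have := pow_eq_zero_iff (two_ne_zero) |>.mp h2
    linarith
  rw [← sq_abs, h3, div_pow, h]
  field_simp

end Matrix

/-! ### The scalar inequality -/

/-- Monotonicity of `ρ + √(N(b - ρ²))` without calculus: `b ≤ (N+1)s²` says that `s` is at or beyond
its maximum, so moving from `s` to `ρ` cannot increase it. -/
theorem le_add_sub_of_sq_le {N s ρ T R b : ℝ} (hN : 1 ≤ N) (hs : 0 ≤ s) (hsρ : s ≤ ρ)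
    (hT : T ^ 2 ≤ N * (b - ρ ^ 2)) (hR : 0 ≤ R) (hR2 : R ^ 2 = N * (b - s ^ 2))
    (hb : b ≤ (N + 1) * s ^ 2) : ρ + T ≤ s + R ∧ (ρ + T = s + R → ρ = s) := by
  obtain ⟨x, rfl⟩ : ∃ x, ρ = s + x := ⟨ρ - s, by ring⟩
  have hx : 0 ≤ x := by linarith
  have hRs : R ≤ N * s := by
    refine le_of_sq_le_sq ?_ (by positivity)
    nlinarith
  have hT2 : T ^ 2 + N * x ^ 2 + 2 * (R * x) ≤ R ^ 2 := by
    have : R * x ≤ N * s * x := mul_le_mul_of_nonneg_right hRs hx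
    nlinarith
  have hxx : x ^ 2 ≤ N * x ^ 2 := le_mul_of_one_le_left (sq_nonneg x) hN
  constructor
  · by_contra! hlt
    rcases le_total x R with hxR | hxR
    · have : (R - x) ^ 2 < T ^ 2 := pow_lt_pow_left₀ (by linarith) (by linarith) two_ne_zero
      nlinarith
    · have : R ^ 2 ≤ x ^ 2 := pow_le_pow_left₀ hR hxR 2
      have h0 : 0 ≤ R * x := mul_nonneg hR hx
      have hT0 : T ^ 2 ≤ 0 := by linarith
      have hT0' : T = 0 := pow_eq_zero_iff two_ne_zero |>.mp (le_antisymm hT0 (sq_nonneg T))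
      subst hT0'
      have : R < x := by linarith
      nlinarith
  · intro h
    have hTR : T = R - x := by linarith
    rw [hTR] at hT2
    have : x ^ 2 = 0 := le_antisymm (by nlinarith) (sq_nonneg x)
    have := pow_eq_zero_iff two_ne_zero |>.mp this
    linarith

/-- The comparison behind the energy bound: `ρ` is the largest absolute value of an eigenvalue of
the symmetric part, `T` the sum of the other ones, `b` the sum of their squares, and `2 * b - a`
the number of closed walks of length `2`. -/
theorem add_le_add_sqrt {N s ρ T a b : ℝ} (hN : 1 ≤ N) (hs : 0 ≤ s) (hsρ : s ≤ ρ)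
    (hT : T ^ 2 ≤ N * (b - ρ ^ 2)) (hba : b ≤ a) (hC : 2 * b - a ≤ (N + 1) * s)
    (hC0 : (2 * b - a = 0 ∧ s = 0) ∨ 1 ≤ s) :
    ρ + T ≤ s + √(N * (a - s ^ 2)) ∧
    (ρ + T = s + √(N * (a - s ^ 2)) →
      (2 * b - a = 0 ∧ (b ≤ 0 ∨ N = 1)) ∨
      (a = b ∧ ρ = s ∧ T ^ 2 = N * (b - s ^ 2) ∧ b ≤ (N + 1) * s ^ 2)) := by
  have hN0 : 0 < N := by linarith
  have hρb : ρ ^ 2 ≤ b := by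
    have : 0 ≤ N * (b - ρ ^ 2) := (sq_nonneg T).trans hT
    linarith [nonneg_of_mul_nonneg_right this hN0]
  have hsb : s ^ 2 ≤ b := (pow_le_pow_left₀ hs hsρ 2).trans hρb
  set r := √(N * (a - s ^ 2)) with hr
  have hr0 : 0 ≤ r := Real.sqrt_nonneg _
  have hr2 : r ^ 2 = N * (a - s ^ 2) := Real.sq_sqrt (mul_nonneg hN0.le (by linarith))
  -- The threshold decides whether `s` is at or past the maximum of `ρ + √(N(b - ρ²))`.
  rcases le_or_gt b ((N + 1) * s ^ 2) with hcase | hcase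
  · have hR0 : 0 ≤ √(N * (b - s ^ 2)) := Real.sqrt_nonneg _
    have hR2 : √(N * (b - s ^ 2)) ^ 2 = N * (b - s ^ 2) :=
      Real.sq_sqrt (mul_nonneg hN0.le (by linarith))
    set R := √(N * (b - s ^ 2))
    have hRr : R ≤ r := by
      apply Real.sqrt_le_sqrt
      exact mul_le_mul_of_nonneg_left (by linarith) hN0.le
    obtain ⟨h1, h2⟩ := le_add_sub_of_sq_le hN hs hsρ hT hR0 hR2 hcase
    refine ⟨by linarith, fun h => Or.inr ?_⟩
    have hRr' : R = r := by linarith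
    have hab : a = b := by
      have h3 : N * (a - s ^ 2) = N * (b - s ^ 2) := by rw [← hr2, ← hR2, hRr']
      have := mul_left_cancel₀ hN0.ne' h3
      linarith
    have hρs : ρ = s := h2 (by linarith)
    refine ⟨hab, hρs, ?_, hcase⟩
    rw [← hR2]
    congr 1
    linarith
  -- Cauchy-Schwarz over all `N + 1` eigenvalues.
  · have hsq : (ρ + T) ^ 2 ≤ (N + 1) * b := by
      have h1 : 0 ≤ (N * ρ - T) ^ 2 := sq_nonneg _
      have h2 : N * (ρ + T) ^ 2 ≤ N * ((N + 1) * b) := by nlinarith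
      exact le_of_mul_le_mul_left h2 hN0
    rcases hC0 with ⟨hC0, rfl⟩ | hs1
    -- Here `r² = 2Nb ≥ (N+1)b`, with equality only for `b = 0` or `N = 1`.
    · have hb : a = 2 * b := by linarith
      have hb0 : 0 ≤ b := by nlinarith
      have hle : (N + 1) * b ≤ r ^ 2 := by rw [hr2, hb]; nlinarith
      refine ⟨by rw [zero_add]; exact le_of_sq_le_sq (hsq.trans hle) hr0, fun h => Or.inl ⟨hC0, ?_⟩⟩
      rw [zero_add] at h
      rw [h, hr2, hb] at hsq
      by_contra! hcon
      have hN1 : 1 < N := lt_of_le_of_ne hN (Ne.symm hcon.2)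
      nlinarith [mul_pos hcon.1 (sub_pos.mpr hN1)]
    · have hlt : (ρ + T) ^ 2 < (s + r) ^ 2 := by
        -- This turns `2b - a ≤ (N+1)s` into a bound quadratic in `s`; it is where `1 ≤ s` is
        -- needed.
        have hss : s ≤ s ^ 2 := by nlinarith
        have h1 : N * s ^ 2 + 2 * (b - (N + 1) * s ^ 2) ≤ a - s ^ 2 := by nlinarith
        have h2 : N * (N * s ^ 2 + 2 * (b - (N + 1) * s ^ 2)) ≤ r ^ 2 := by
          rw [hr2]; exact mul_le_mul_of_nonneg_left h1 hN0.le
        have h6 : 0 < b - (N + 1) * s ^ 2 := by linarith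
        have h3 : N * s < r := by
          refine lt_of_pow_lt_pow_left₀ 2 hr0 ?_
          nlinarith [mul_pos hN0 h6]
        have h4 : s * (N * s) < s * r := mul_lt_mul_of_pos_left h3 (by linarith)
        have h5 : (N + 1) ^ 2 * s ^ 2 + 2 * N * (b - (N + 1) * s ^ 2) < (s + r) ^ 2 := by
          linarith [h2, h4, (by ring : (s + r) ^ 2 = s ^ 2 + 2 * (s * r) + r ^ 2), (by ring :
            (N + 1) ^ 2 * s ^ 2 = s ^ 2 + 2 * (s * (N * s)) + N * (N * s ^ 2))]
        nlinarith
      have := lt_of_pow_lt_pow_left₀ 2 (by linarith) hlt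
      exact ⟨this.le, fun h => absurd h this.ne⟩

/-! ### Walk counts, the symmetric part of a digraph, and the energy bound -/

noncomputable section

namespace Digraph

open Classical Matrix

variable {V : Type*} (D : Digraph V)

/-- The adjacency matrix of a digraph with real entries. -/
def realAdj : Matrix V V ℝ := Matrix.of fun u v => if D.Adj u v then 1 else 0

theorem realAdj_apply (u v : V) : D.realAdj u v = if D.Adj u v then 1 else 0 := rfl

theorem adjacencyMatrix_eq_map : D.adjacencyMatrix = D.realAdj.map Complex.ofReal := by
  ext u v
  by_cases h : D.Adj u v <;> simp [adjacencyMatrix, realAdj, h]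

/-- The symmetric part of the adjacency matrix. -/
def symmPart : Matrix V V ℝ := (1 / 2 : ℝ) • (D.realAdj + D.realAdjᵀ)

theorem symmPart_apply (u v : V) : D.symmPart u v = (D.realAdj u v + D.realAdj v u) / 2 := by
  simp [symmPart]
  ring

theorem isHermitian_symmPart : D.symmPart.IsHermitian := by
  ext u v
  simp only [conjTranspose_apply, symmPart_apply, star_trivial]
  ring

theorem realAdj_add_transpose : D.realAdj + D.realAdjᵀ = (2 : ℝ) • D.symmPart := by
  simp [symmPart, smul_smul]

variable [Fintype V]

theorem sum_realAdj : ∑ u, ∑ v, D.realAdj u v = D.numArcs := by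
  rw [numArcs, Finset.card_filter, Fintype.sum_prod_type]
  simp [realAdj_apply]

theorem closedTwoWalks_eq (v : V) :
    (D.closedTwoWalks v : ℝ) = ∑ w, D.realAdj v w * D.realAdj w v := by
  rw [closedTwoWalks, doublyAdjacent, Finset.card_filter, Nat.cast_sum]
  refine Finset.sum_congr rfl fun w _ => ?_
  by_cases h1 : D.Adj v w <;> by_cases h2 : D.Adj w v <;> simp [realAdj_apply, h1, h2]

theorem twoWalkSum_eq (v : V) : (D.twoWalkSum v : ℝ) =
    ∑ w, D.realAdj v w * D.realAdj w v * D.closedTwoWalks w := by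
  simp only [twoWalkSum, doublyAdjacent, realAdj_apply, Finset.sum_filter, Nat.cast_sum]
  refine Finset.sum_congr rfl fun w _ => ?_
  by_cases h1 : D.Adj v w <;> by_cases h2 : D.Adj w v <;> simp [h1, h2]

theorem energy_le_sum_abs_eigenvalues :
    D.energy ≤ ∑ k, |D.isHermitian_symmPart.eigenvalues k| := by
  rw [energy, eigenvalues, adjacencyMatrix_eq_map]
  exact sum_abs_re_roots_charpoly_le _ _ D.isHermitian_symmPart D.realAdj_add_transpose

/-- An ordered pair joined by one arc contributes `1/4`, a doubly adjacent one contributes `1`. -/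
theorem sum_sq_symmPart : ∑ u, ∑ v, D.symmPart u v ^ 2 =
    ((D.numArcs : ℝ) + ∑ v, (D.closedTwoWalks v : ℝ)) / 2 := by
  have h : ∀ u v, D.symmPart u v ^ 2 =
      (D.realAdj u v + D.realAdj v u) / 4 + D.realAdj u v * D.realAdj v u / 2 := by
    intro u v
    rw [symmPart_apply, realAdj_apply, realAdj_apply]
    split_ifs <;> norm_num
  simp only [h, Finset.sum_add_distrib, ← Finset.sum_div, closedTwoWalks_eq]
  rw [Finset.sum_comm (f := fun u v => D.realAdj v u), sum_realAdj]
  ring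

theorem sum_closedTwoWalks_le : ∑ v, (D.closedTwoWalks v : ℝ) ≤ D.numArcs := by
  rw [← sum_realAdj]
  refine Finset.sum_le_sum fun v _ => ?_
  rw [closedTwoWalks_eq]
  refine Finset.sum_le_sum fun w _ => ?_
  rw [realAdj_apply, realAdj_apply]
  split_ifs <;> norm_num

/-- If as many closed walks of length `2` as arcs exist, every arc can be reversed. -/
theorem adj_symm_of_sum_closedTwoWalks_eq (h : ∑ v, (D.closedTwoWalks v : ℝ) = D.numArcs)
    {u v : V} (huv : D.Adj u v) : D.Adj v u := by
  by_contra hvu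
  refine absurd h (ne_of_lt ?_)
  have hle : ∀ u v, D.realAdj u v * D.realAdj v u ≤ D.realAdj u v := by
    intro u v
    rw [realAdj_apply, realAdj_apply]
    split_ifs <;> norm_num
  rw [← sum_realAdj]
  simp only [closedTwoWalks_eq]
  refine Finset.sum_lt_sum (fun w _ => Finset.sum_le_sum fun x _ => hle w x)
    ⟨u, Finset.mem_univ _, Finset.sum_lt_sum (fun x _ => hle u x) ⟨v, Finset.mem_univ _, ?_⟩⟩
  simp [realAdj_apply, huv, hvu]

/-- Double adjacency is symmetric, so every term of the sum defining `twoWalkSum` is at least one.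
This is what makes `q ≥ 1` when closed 2-walks exist. -/
theorem closedTwoWalks_le_twoWalkSum (v : V) : D.closedTwoWalks v ≤ D.twoWalkSum v := by
  rw [closedTwoWalks, twoWalkSum, Finset.card_eq_sum_ones]
  refine Finset.sum_le_sum fun w hw => ?_
  refine Finset.card_pos.mpr ⟨v, ?_⟩
  simp only [doublyAdjacent, Finset.mem_filter, Finset.mem_univ, true_and] at hw ⊢
  exact hw.symm

theorem sum_twoWalkSum : ∑ v, (D.twoWalkSum v : ℝ) = ∑ v, (D.closedTwoWalks v : ℝ) ^ 2 := by
  simp only [twoWalkSum_eq]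
  rw [Finset.sum_comm]
  refine Finset.sum_congr rfl fun w _ => ?_
  rw [← Finset.sum_mul, sq, closedTwoWalks_eq]
  congr 1
  exact Finset.sum_congr rfl fun v _ => mul_comm _ _

theorem walkQuotient_nonneg : 0 ≤ D.walkQuotient :=
  div_nonneg (Finset.sum_nonneg fun _ _ => sq_nonneg _) (Finset.sum_nonneg fun _ _ => sq_nonneg _)

theorem sum_sq_closedTwoWalks_pos {v : V} (hv : D.closedTwoWalks v ≠ 0) :
    0 < ∑ v, (D.closedTwoWalks v : ℝ) ^ 2 :=
  Finset.sum_pos' (fun _ _ => sq_nonneg _) ⟨v, Finset.mem_univ _, by positivity⟩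

theorem walkQuotient_mul {v : V} (hv : D.closedTwoWalks v ≠ 0) :
    D.walkQuotient * ∑ v, (D.closedTwoWalks v : ℝ) ^ 2 = ∑ v, (D.twoWalkSum v : ℝ) ^ 2 :=
  div_mul_cancel₀ _ (D.sum_sq_closedTwoWalks_pos hv).ne'

theorem walkQuotient_eq_zero (h : ∀ v, D.closedTwoWalks v = 0) : D.walkQuotient = 0 := by
  simp [walkQuotient, h]

theorem one_le_walkQuotient {v : V} (hv : D.closedTwoWalks v ≠ 0) : 1 ≤ D.walkQuotient := by
  rw [walkQuotient, one_le_div (D.sum_sq_closedTwoWalks_pos hv)]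
  refine Finset.sum_le_sum fun v _ => pow_le_pow_left₀ (Nat.cast_nonneg _) ?_ 2
  exact_mod_cast D.closedTwoWalks_le_twoWalkSum v

/-- Cauchy-Schwarz twice: `(∑ c)² ≤ n ∑ c²`, and `(∑ c²)² = (∑ t)² ≤ n ∑ t² = n q ∑ c²`. -/
theorem sum_closedTwoWalks_le_card_mul_sqrt :
    ∑ v, (D.closedTwoWalks v : ℝ) ≤ Fintype.card V * √D.walkQuotient := by
  by_cases h : ∀ v, D.closedTwoWalks v = 0
  · simp only [h, Nat.cast_zero, Finset.sum_const_zero]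
    positivity
  push Not at h
  obtain ⟨v, hv⟩ := h
  have hpos := D.sum_sq_closedTwoWalks_pos hv
  have hq := D.walkQuotient_mul hv
  set Q := ∑ v, (D.closedTwoWalks v : ℝ) ^ 2
  refine le_of_sq_le_sq ?_ (by positivity)
  rw [mul_pow, Real.sq_sqrt D.walkQuotient_nonneg]
  have h1 := sq_sum_le_card_mul_sum_sq (s := Finset.univ) (f := fun v => (D.closedTwoWalks v : ℝ))
  have h2 := sq_sum_le_card_mul_sum_sq (s := Finset.univ) (f := fun v => (D.twoWalkSum v : ℝ))
  rw [sum_twoWalkSum, ← hq] at h2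
  rw [Finset.card_univ] at h1 h2
  have h3 : Q ≤ Fintype.card V * D.walkQuotient := by
    refine le_of_mul_le_mul_right ?_ hpos
    calc Q * Q = Q ^ 2 := by ring
      _ ≤ _ := h2
      _ = _ := by ring
  calc _ ≤ (Fintype.card V : ℝ) * Q := h1
    _ ≤ Fintype.card V * (Fintype.card V * D.walkQuotient) :=
      mul_le_mul_of_nonneg_left h3 (Nat.cast_nonneg _)
    _ = _ := by ring

/-- The test vector is `c`: the symmetric part has entry one at doubly adjacent pairs and no
negative entry, so it sends `c` to a vector at least `t`. -/
theorem exists_walkQuotient_le_sq_eigenvalues [Nonempty V] :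
    ∃ k, D.walkQuotient ≤ D.isHermitian_symmPart.eigenvalues k ^ 2 := by
  by_cases h : ∀ v, D.closedTwoWalks v = 0
  · exact ⟨Classical.arbitrary V, by rw [D.walkQuotient_eq_zero h]; positivity⟩
  push Not at h
  obtain ⟨v, hv⟩ := h
  refine D.isHermitian_symmPart.exists_le_sq_eigenvalues
    (x := fun v => (D.closedTwoWalks v : ℝ)) ?_ ?_
  · exact fun h0 => hv (Nat.cast_eq_zero.mp (congrFun h0 v))
  · rw [D.walkQuotient_mul hv]
    refine Finset.sum_le_sum fun u _ => pow_le_pow_left₀ (Nat.cast_nonneg _) ?_ 2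
    rw [twoWalkSum_eq, mulVec, dotProduct]
    refine Finset.sum_le_sum fun w _ => mul_le_mul_of_nonneg_right ?_ (Nat.cast_nonneg _)
    rw [symmPart_apply, realAdj_apply, realAdj_apply]
    split_ifs <;> norm_num

/-- The energy bound for digraphs with at least two vertices, with necessary conditions for
equality. -/
theorem energy_bound (hn : 1 < Fintype.card V) :
    D.walkQuotient ≤ D.numArcs ∧
    D.energy ≤ √D.walkQuotient +
      √(((Fintype.card V : ℝ) - 1) * ((D.numArcs : ℝ) - D.walkQuotient)) ∧
    (D.energy = √D.walkQuotient +
        √(((Fintype.card V : ℝ) - 1) * ((D.numArcs : ℝ) - D.walkQuotient)) →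
      (∑ v, (D.closedTwoWalks v : ℝ) = 0 ∧ (D.numArcs = 0 ∨ Fintype.card V = 2)) ∨
      (∑ v, (D.closedTwoWalks v : ℝ) = D.numArcs ∧
        (D.numArcs : ℝ) ≤ Fintype.card V * D.walkQuotient ∧
        ∃ k₀, D.isHermitian_symmPart.eigenvalues k₀ ^ 2 = D.walkQuotient ∧
          ∀ k, k ≠ k₀ → D.isHermitian_symmPart.eigenvalues k ^ 2 =
            ((D.numArcs : ℝ) - D.walkQuotient) / ((Fintype.card V : ℝ) - 1))) := by
  have hne : Nonempty V := Fintype.card_pos_iff.mp (by omega)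
  obtain ⟨k₀, hk₀⟩ := D.exists_walkQuotient_le_sq_eigenvalues
  have hE := D.energy_le_sum_abs_eigenvalues
  have hb := D.isHermitian_symmPart.sum_sq_eigenvalues
  rw [sum_sq_symmPart] at hb
  set lam := D.isHermitian_symmPart.eigenvalues with hlam
  set T := ∑ k ∈ Finset.univ.erase k₀, |lam k| with hTdef
  set C := ∑ v, (D.closedTwoWalks v : ℝ) with hC
  set a := (D.numArcs : ℝ) with ha
  have hT := sq_sum_erase_abs_le lam k₀
  have hsum : ∑ k, |lam k| = |lam k₀| + T :=
    (Finset.add_sum_erase _ _ (Finset.mem_univ k₀)).symm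
  rw [hsum] at hE
  have hq0 := D.walkQuotient_nonneg
  have hs2 : √D.walkQuotient ^ 2 = D.walkQuotient := Real.sq_sqrt hq0
  have hCa : C ≤ a := D.sum_closedTwoWalks_le
  have hN : (1 : ℝ) ≤ (Fintype.card V : ℝ) - 1 := by
    have : (2 : ℝ) ≤ Fintype.card V := by exact_mod_cast hn
    linarith
  have hC0 : C = 0 ∧ √D.walkQuotient = 0 ∨ 1 ≤ √D.walkQuotient := by
    by_cases h : ∀ v, D.closedTwoWalks v = 0
    · exact Or.inl ⟨by simp [hC, h], by simp [D.walkQuotient_eq_zero h]⟩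
    · push Not at h
      obtain ⟨v, hv⟩ := h
      exact Or.inr (Real.one_le_sqrt.mpr (D.one_le_walkQuotient hv))
  have hT' : T ^ 2 ≤ ((Fintype.card V : ℝ) - 1) * (∑ k, lam k ^ 2 - |lam k₀| ^ 2) := by
    rwa [sq_abs]
  have hCs := D.sum_closedTwoWalks_le_card_mul_sqrt
  have key := add_le_add_sqrt (N := (Fintype.card V : ℝ) - 1) (s := √D.walkQuotient)
    (ρ := |lam k₀|) (T := T) (a := a) (b := ∑ k, lam k ^ 2) hN (Real.sqrt_nonneg _)
    (Real.sqrt_le_iff.mpr ⟨abs_nonneg _, by rwa [sq_abs]⟩) hT' (by linarith)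
    (by rw [hb]; linarith) (by rw [hb]; convert hC0 using 2; ring_nf)
  rw [hs2] at key
  obtain ⟨k1, k2⟩ := key
  refine ⟨?_, hE.trans k1, fun heq => ?_⟩
  · have : lam k₀ ^ 2 ≤ ∑ k, lam k ^ 2 :=
      Finset.single_le_sum (f := fun k => lam k ^ 2) (fun _ _ => sq_nonneg _) (Finset.mem_univ k₀)
    linarith
  · rcases k2 (le_antisymm k1 (heq ▸ hE)) with ⟨h1, h2⟩ | ⟨h1, h2, h3, h4⟩
    · left
      have hC0 : C = 0 := by linarith
      refine ⟨hC0, h2.imp (fun h => ?_) fun h => ?_⟩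
      · have h0 : (0 : ℝ) ≤ D.numArcs := Nat.cast_nonneg _
        have : (D.numArcs : ℝ) = 0 := by linarith
        exact_mod_cast this
      · have : (Fintype.card V : ℝ) = 2 := by linarith
        exact_mod_cast this
    · right
      have hk : lam k₀ ^ 2 = D.walkQuotient := by rw [← hs2, ← h2, sq_abs]
      refine ⟨by linarith, by linarith, k₀, hk, fun k hkk => ?_⟩
      rw [sq_eq_of_sq_sum_erase_abs_eq hn lam k₀ (by rw [hk]; exact h3) k hkk, hk, h1]

end Digraph

end

/-! ### Energy when the squared adjacency matrix lies in the span of `I` and `J` -/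

open Classical in
/-- The trace norm of a symmetric matrix with constant row sums whose square is a combination of
the identity and the all-ones matrix. -/
theorem Matrix.IsHermitian.sum_abs_eigenvalues_of_mul_self_eq {V : Type*} [Fintype V] [Nonempty V]
    {A : Matrix V V ℝ} (hA : A.IsHermitian) {k θ μ : ℝ} (hk : 0 ≤ k) (hθ : 0 ≤ θ)
    (hrow : ∀ u, ∑ v, A u v = k)
    (hsq : ∀ u v, (A * A) u v = (if u = v then θ ^ 2 else 0) + μ) :
    ∑ i, |hA.eigenvalues i| = Fintype.card V * θ + (k - θ) := by
  obtain ⟨O, hO, hAO⟩ := hA.exists_orthogonal_diagonalization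
  have hn : (Fintype.card V : ℝ) ≠ 0 := Nat.cast_ne_zero.mpr Fintype.card_ne_zero
  have hcolsum : ∀ v, ∑ u, A u v = k := by
    intro v
    rw [← hrow v]
    exact Finset.sum_congr rfl fun u _ => by simpa using hA.apply v u
  have hksq : k ^ 2 = θ ^ 2 + Fintype.card V * μ := by
    obtain ⟨u⟩ := ‹Nonempty V›
    have h1 : ∑ v, (A * A) u v = k ^ 2 := by
      simp only [Matrix.mul_apply]
      rw [Finset.sum_comm]
      simp only [← Finset.mul_sum, hrow, ← Finset.sum_mul, sq]
    rw [← h1]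
    simp [hsq, Finset.sum_add_distrib]
  have hAO' : A * O = O * Matrix.diagonal hA.eigenvalues := by
    conv_lhs => rw [hAO]
    rw [Matrix.mul_assoc, hO, Matrix.mul_one]
  have heig : ∀ u j, ∑ v, A u v * O v j = hA.eigenvalues j * O u j := by
    intro u j
    have := congrFun (congrFun hAO' u) j
    rw [Matrix.mul_diagonal, Matrix.mul_apply] at this
    rw [this, mul_comm]
  have hsum : ∀ j, k * ∑ u, O u j = hA.eigenvalues j * ∑ u, O u j := by
    intro j
    rw [Finset.mul_sum, Finset.mul_sum]
    simp only [← heig]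
    rw [Finset.sum_comm]
    simp only [← Finset.sum_mul, hcolsum]
  have hsq' : ∀ u j, hA.eigenvalues j ^ 2 * O u j = θ ^ 2 * O u j + μ * ∑ v, O v j := by
    intro u j
    have h1 : ∑ v, (A * A) u v * O v j = hA.eigenvalues j ^ 2 * O u j := by
      simp only [Matrix.mul_apply, Finset.sum_mul]
      rw [Finset.sum_comm]
      simp only [mul_assoc, ← Finset.mul_sum, heig]
      simp only [mul_left_comm _ (hA.eigenvalues j), ← Finset.mul_sum, heig]
      ring
    rw [← h1]
    simp [hsq, add_mul, Finset.sum_add_distrib, Finset.mul_sum]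
  -- The matrix `θ I + ((k-θ)/n) J` acts on the eigenbasis as `|A|`: an eigenvector with zero
  -- coordinate sum has `λ² = θ²`, and any other has `λ = k`.
  have habs : ∀ u j, θ * O u j + (k - θ) / Fintype.card V * ∑ v, O v j =
      |hA.eigenvalues j| * O u j := by
    intro u j
    by_cases h0 : ∑ v, O v j = 0
    · have h1 := hsq' u j
      rw [h0] at h1 ⊢
      by_cases hO0 : O u j = 0
      · simp [hO0]
      have h2 : hA.eigenvalues j ^ 2 = θ ^ 2 := mul_right_cancel₀ hO0 (by linarith)
      rw [(sq_eq_sq_iff_abs_eq_abs _ _).mp h2, abs_of_nonneg hθ]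
      ring
    · have hlam : hA.eigenvalues j = k := (mul_right_cancel₀ h0 (hsum j)).symm
      have h1 := hsq' u j
      rw [hlam] at h1 ⊢
      rw [abs_of_nonneg hk]
      -- For `μ = 0` the eigenvector need not be constant, but then `k = θ`; otherwise it is
      -- constant.
      by_cases hμ : μ = 0
      · have : k ^ 2 = θ ^ 2 := by rw [hksq, hμ]; ring
        have : k = θ := (sq_eq_sq₀ hk hθ).mp this
        simp [this]
      · rw [hksq] at h1
        have : ∑ v, O v j = Fintype.card V * O u j := by
          refine mul_left_cancel₀ hμ ?_
          linarith
        rw [this]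
        field_simp
        ring
  set P : Matrix V V ℝ := θ • 1 + ((k - θ) / Fintype.card V) • Matrix.of fun _ _ => 1 with hP
  have hPO : P * O = O * Matrix.diagonal fun j => |hA.eigenvalues j| := by
    ext u j
    rw [Matrix.mul_diagonal, mul_comm (O u j), ← habs, hP, Matrix.add_mul, Matrix.add_apply,
      Matrix.smul_mul, Matrix.smul_mul, Matrix.one_mul, Matrix.smul_apply, Matrix.smul_apply,
      Matrix.mul_apply]
    simp
  have htr : P.trace = ∑ j, |hA.eigenvalues j| := by
    have h1 : P = O * (Matrix.diagonal fun j => |hA.eigenvalues j|) * O.transpose := by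
      rw [← hPO, Matrix.mul_assoc, mul_eq_one_comm.mp hO, Matrix.mul_one]
    rw [h1, Matrix.mul_assoc, Matrix.trace_mul_comm, Matrix.mul_assoc, hO, Matrix.mul_one,
      Matrix.trace_diagonal]
  rw [← htr, hP]
  simp only [Matrix.trace, Matrix.diag_apply, Matrix.add_apply, Matrix.smul_apply,
    Matrix.one_apply_eq, Matrix.of_apply, smul_eq_mul, mul_one, Finset.sum_const,
    Finset.card_univ, nsmul_eq_mul]
  field_simp

open Classical in
theorem Digraph.energy_eq_sum_abs_eigenvalues {V : Type*} [Fintype V] (D : Digraph V)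
    (hD : D.realAdj.IsHermitian) : D.energy = ∑ i, |hD.eigenvalues i| := by
  have h : D.adjacencyMatrix.charpoly =
      ((Finset.univ.val.map fun i => (hD.eigenvalues i : ℂ)).map fun z =>
        (Polynomial.X - Polynomial.C z)).prod := by
    have h1 : D.adjacencyMatrix = Complex.ofRealHom.mapMatrix D.realAdj := D.adjacencyMatrix_eq_map
    rw [h1, RingHom.mapMatrix_apply, Matrix.charpoly_map, hD.charpoly_eq, Polynomial.map_prod,
      Multiset.map_map]
    simp
  rw [energy, eigenvalues, h, Polynomial.roots_multiset_prod_X_sub_C, Multiset.map_map]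
  simp

namespace SimpleGraph

open Classical

variable {V : Type*} (G : SimpleGraph V)

theorem realAdj_symmetricDigraph_apply (u v : V) :
    G.symmetricDigraph.realAdj u v = if G.Adj u v then 1 else 0 := rfl

theorem realAdj_symmetricDigraph_comm (u v : V) :
    G.symmetricDigraph.realAdj u v = G.symmetricDigraph.realAdj v u := by
  rw [realAdj_symmetricDigraph_apply, realAdj_symmetricDigraph_apply, G.adj_comm]

theorem realAdj_self (u : V) : G.symmetricDigraph.realAdj u u = 0 := by
  simp [realAdj_symmetricDigraph_apply]

theorem isHermitian_realAdj_symmetricDigraph : G.symmetricDigraph.realAdj.IsHermitian := by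
  ext u v
  simp [G.realAdj_symmetricDigraph_comm u v]

theorem symmPart_symmetricDigraph : G.symmetricDigraph.symmPart = G.symmetricDigraph.realAdj := by
  ext u v
  rw [Digraph.symmPart_apply, G.realAdj_symmetricDigraph_comm v u, add_self_div_two]

theorem adjMatrix_eq_realAdj : G.adjMatrix ℝ = G.symmetricDigraph.realAdj := by
  ext u v
  simp [realAdj_symmetricDigraph_apply]

variable [Fintype V]

theorem closedTwoWalks_symmetricDigraph (v : V) :
    (G.symmetricDigraph.closedTwoWalks v : ℝ) = ∑ w, G.symmetricDigraph.realAdj v w := by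
  rw [Digraph.closedTwoWalks_eq]
  refine Finset.sum_congr rfl fun w _ => ?_
  rw [G.realAdj_symmetricDigraph_comm w v, realAdj_symmetricDigraph_apply]
  split_ifs <;> simp

theorem twoWalkSum_symmetricDigraph (v : V) : (G.symmetricDigraph.twoWalkSum v : ℝ) =
    ∑ w, G.symmetricDigraph.realAdj v w * G.symmetricDigraph.closedTwoWalks w := by
  rw [Digraph.twoWalkSum_eq]
  refine Finset.sum_congr rfl fun w _ => ?_
  rw [G.realAdj_symmetricDigraph_comm w v, realAdj_symmetricDigraph_apply]
  split_ifs <;> simp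

/-- For a regular graph, `q` is the square of the degree. -/
theorem walkQuotient_of_regular [Nonempty V] {k : ℝ}
    (hrow : ∀ u, ∑ v, G.symmetricDigraph.realAdj u v = k) :
    G.symmetricDigraph.walkQuotient = k ^ 2 := by
  have hc : ∀ v, (G.symmetricDigraph.closedTwoWalks v : ℝ) = k := fun v => by
    rw [closedTwoWalks_symmetricDigraph, hrow]
  have ht : ∀ v, (G.symmetricDigraph.twoWalkSum v : ℝ) = k ^ 2 := fun v => by
    simp only [twoWalkSum_symmetricDigraph, hc, ← Finset.sum_mul, hrow, sq]
  have hn : (Fintype.card V : ℝ) ≠ 0 := Nat.cast_ne_zero.mpr Fintype.card_ne_zero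
  simp only [Digraph.walkQuotient, hc, ht, Finset.sum_const, Finset.card_univ, nsmul_eq_mul]
  by_cases hk : k = 0
  · simp [hk]
  · field_simp

/-- The energy bound is attained by regular graphs the square of whose adjacency matrix is a
combination of the identity and the all-ones matrix. -/
theorem energy_eq_of_mul_self_eq [Nonempty V] {k θ μ : ℝ} (hθ : 0 ≤ θ)
    (hrow : ∀ u, ∑ v, G.symmetricDigraph.realAdj u v = k)
    (hsq : ∀ u v, (G.symmetricDigraph.realAdj * G.symmetricDigraph.realAdj) u v =
      (if u = v then θ ^ 2 else 0) + μ) :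
    G.symmetricDigraph.energy = √G.symmetricDigraph.walkQuotient +
      √(((Fintype.card V : ℝ) - 1) *
        ((G.symmetricDigraph.numArcs : ℝ) - G.symmetricDigraph.walkQuotient)) := by
  obtain ⟨u⟩ := id ‹Nonempty V›
  have hk : 0 ≤ k := by
    rw [← hrow u, ← closedTwoWalks_symmetricDigraph]
    exact Nat.cast_nonneg _
  have hA := G.isHermitian_realAdj_symmetricDigraph
  have ha : (G.symmetricDigraph.numArcs : ℝ) = Fintype.card V * k := by
    rw [← Digraph.sum_realAdj]
    simp [hrow]
  -- The diagonal of `A²` lists the degrees.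
  have hkθ : k = θ ^ 2 + μ := by
    have h1 := hsq u u
    rw [if_pos rfl, Matrix.mul_apply] at h1
    rw [← h1, ← hrow u]
    refine Finset.sum_congr rfl fun w _ => ?_
    rw [G.realAdj_symmetricDigraph_comm w u, realAdj_symmetricDigraph_apply]
    split_ifs <;> simp
  have hksq : k ^ 2 = θ ^ 2 + Fintype.card V * μ := by
    have h1 : ∑ v, (G.symmetricDigraph.realAdj * G.symmetricDigraph.realAdj) u v = k ^ 2 := by
      simp only [Matrix.mul_apply]
      rw [Finset.sum_comm]
      simp only [← Finset.mul_sum, hrow, ← Finset.sum_mul, sq]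
    rw [← h1]
    simp [hsq, Finset.sum_add_distrib]
  have hn : (1 : ℝ) ≤ Fintype.card V := by exact_mod_cast Fintype.card_pos
  rw [G.symmetricDigraph.energy_eq_sum_abs_eigenvalues hA,
    hA.sum_abs_eigenvalues_of_mul_self_eq hk hθ hrow hsq, G.walkQuotient_of_regular hrow,
    Real.sqrt_sq hk, ha]
  have h2 : ((Fintype.card V : ℝ) - 1) * (Fintype.card V * k - k ^ 2) =
      (((Fintype.card V : ℝ) - 1) * θ) ^ 2 := by
    rw [hksq, hkθ]; ring
  rw [h2, Real.sqrt_sq (mul_nonneg (by linarith) hθ)]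
  ring

end SimpleGraph

/-! ### The listed graphs attain the bound -/

namespace SimpleGraph

open Classical

variable {V : Type*} (G : SimpleGraph V)

/-- Replaces the isomorphism by the map sending a vertex to its unique neighbour. -/
theorem IsHalfCopiesK2.exists_adj_iff {G : SimpleGraph V} (h : G.IsHalfCopiesK2) :
    ∃ f : V → V, ∀ u v, G.Adj u v ↔ v = f u := by
  obtain ⟨m, ⟨e⟩⟩ := h
  refine ⟨fun u => e.symm ((e u).1, (e u).2 + 1), fun u v => ?_⟩
  rw [← e.map_adj_iff, eq_comm, ← e.injective.eq_iff]
  have h2 : ∀ i j : Fin 2, i ≠ j ↔ i + 1 = j := by decide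
  simp only [RelIso.apply_symm_apply]
  simp [disjointCopies, completeGraph, Prod.ext_iff, h2]

theorem IsHalfCopiesK2.of_adj_iff [Fintype V] {f : V → V} (h : ∀ u v, G.Adj u v ↔ v = f u) :
    G.IsHalfCopiesK2 := by
  have hff : ∀ u, f (f u) = u := fun u =>
    ((h _ _).mp (G.symm.symm _ _ ((h u (f u)).mpr rfl))).symm
  have hne : ∀ u, f u ≠ u := fun u hu => G.irrefl ((h u u).mpr hu.symm)
  let g := Fintype.equivFin V
  -- An enumeration of `V` selects one endpoint of each edge, which indexes the copies of `K₂`.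
  let W := {v : V // g v < g (f v)}
  let e : Fin (Fintype.card W) ≃ W := (Fintype.equivFin W).symm
  let φ : Fin (Fintype.card W) × Fin 2 → V := fun p =>
    if p.2 = 0 then (e p.1).1 else f (e p.1).1
  have hφf : ∀ p, f (φ p) = φ (p.1, p.2 + 1) := by
    rintro ⟨i, j⟩
    fin_cases j <;> simp [φ, hff]
  have hinj0 : ∀ i j, (e i).1 ≠ f (e j).1 := by
    intro i j hij
    have h1 := (e i).2
    have h2 := (e j).2
    rw [hij, hff] at h1
    exact lt_asymm h1 h2
  have hfinj : Function.Injective f := Function.LeftInverse.injective hff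
  have hinj : Function.Injective φ := by
    rintro ⟨i, j⟩ ⟨i', j'⟩ hij
    fin_cases j <;> fin_cases j' <;> simp only [φ] at hij
    · simpa [Subtype.ext_iff.symm] using hij
    · exact absurd (by simpa using hij) (hinj0 i i')
    · exact absurd (by simpa using hij.symm) (hinj0 i' i)
    · have : f (e i).1 = f (e i').1 := by simpa using hij
      simpa [Subtype.ext_iff.symm] using hfinj this
  have hsurj : Function.Surjective φ := by
    intro v
    rcases lt_or_gt_of_ne (fun h => hne v (g.injective h).symm : g v ≠ g (f v)) with hv | hv
    · exact ⟨(e.symm ⟨v, hv⟩, 0), by simp [φ]⟩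
    · exact ⟨(e.symm ⟨f v, by rwa [hff]⟩, 1), by simp [φ, hff]⟩
  refine ⟨Fintype.card W, ⟨(RelIso.mk (Equiv.ofBijective φ ⟨hinj, hsurj⟩) ?_ : _ ≃g G).symm⟩⟩
  intro p q
  have h2 : ∀ i j : Fin 2, i ≠ j ↔ j = i + 1 := by decide
  change G.Adj (φ p) (φ q) ↔ _
  rw [h, hφf, hinj.eq_iff]
  simp [disjointCopies, completeGraph, Prod.ext_iff, h2, eq_comm]

variable [Fintype V]

theorem mul_self_realAdj_apply (u v : V) :
    (G.symmetricDigraph.realAdj * G.symmetricDigraph.realAdj) u v =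
      ∑ w, if G.Adj u w ∧ G.Adj v w then 1 else 0 := by
  rw [Matrix.mul_apply]
  refine Finset.sum_congr rfl fun w _ => ?_
  rw [G.realAdj_symmetricDigraph_comm w v, realAdj_symmetricDigraph_apply,
    realAdj_symmetricDigraph_apply]
  by_cases h1 : G.Adj u w <;> by_cases h2 : G.Adj v w <;> simp [h1, h2]

theorem energy_eq_of_isHalfCopiesK2 [Nonempty V] (h : G.IsHalfCopiesK2) :
    G.symmetricDigraph.energy = √G.symmetricDigraph.walkQuotient +
      √(((Fintype.card V : ℝ) - 1) *
        ((G.symmetricDigraph.numArcs : ℝ) - G.symmetricDigraph.walkQuotient)) := by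
  obtain ⟨f, hf⟩ := h.exists_adj_iff
  have hff : ∀ u, f (f u) = u := fun u =>
    ((hf _ _).mp (G.symm.symm _ _ ((hf u (f u)).mpr rfl))).symm
  have hfinj : Function.Injective f := Function.LeftInverse.injective hff
  refine G.energy_eq_of_mul_self_eq (k := 1) (θ := 1) (μ := 0) zero_le_one ?_ ?_
  · intro u
    simp [realAdj_symmetricDigraph_apply, hf]
  · intro u v
    rw [mul_self_realAdj_apply]
    by_cases huv : u = v
    · simp [huv, hf]
    · rw [if_neg huv, add_zero]
      refine Finset.sum_eq_zero fun w _ => if_neg ?_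
      rintro ⟨h1, h2⟩
      exact huv (hfinj (((hf _ _).mp h1).symm.trans ((hf _ _).mp h2)))

theorem energy_eq_of_top [Nonempty V] :
    (⊤ : SimpleGraph V).symmetricDigraph.energy =
      √(⊤ : SimpleGraph V).symmetricDigraph.walkQuotient +
      √(((Fintype.card V : ℝ) - 1) * (((⊤ : SimpleGraph V).symmetricDigraph.numArcs : ℝ) -
        (⊤ : SimpleGraph V).symmetricDigraph.walkQuotient)) := by
  have hA : ∀ u v : V, (⊤ : SimpleGraph V).symmetricDigraph.realAdj u v =
      1 - if u = v then 1 else 0 := by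
    intro u v
    rw [realAdj_symmetricDigraph_apply, top_adj]
    by_cases h : u = v <;> simp [h]
  -- `(J - I)² = I + (n-2) J`; on a single vertex `μ = -1`, which is allowed.
  refine energy_eq_of_mul_self_eq ⊤ (k := Fintype.card V - 1) (θ := 1)
    (μ := Fintype.card V - 2) zero_le_one ?_ ?_
  · intro u
    simp [hA]
  · intro u v
    simp only [Matrix.mul_apply, hA, sub_mul, mul_sub, one_mul, mul_one, Finset.sum_sub_distrib]
    by_cases huv : u = v <;> simp [huv] <;> ring

/-- An eigenvector of a real matrix for an element of its spectrum. -/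
theorem _root_.Matrix.exists_mulVec_eq_smul_of_mem_spectrum {A : Matrix V V ℝ} {x : ℝ}
    (hx : x ∈ spectrum ℝ A) : ∃ y : V → ℝ, y ≠ 0 ∧ A.mulVec y = x • y := by
  rw [← Matrix.spectrum_toLin', ← Module.End.hasEigenvalue_iff_mem_spectrum] at hx
  obtain ⟨y, hy⟩ := hx.exists_hasEigenvector
  exact ⟨y, hy.2, by simpa using hy.apply_eq_smul⟩

theorem _root_.Matrix.mem_spectrum_of_mulVec_eq_smul {A : Matrix V V ℝ} {x : ℝ} {y : V → ℝ}
    (hy : y ≠ 0) (h : A.mulVec y = x • y) : x ∈ spectrum ℝ A := by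
  rw [← Matrix.spectrum_toLin', ← Module.End.hasEigenvalue_iff_mem_spectrum]
  exact Module.End.hasEigenvalue_of_hasEigenvector (x := y)
    ⟨Module.End.mem_eigenspace_iff.mpr (by simpa using h), hy⟩

/-- Eigenvectors for eigenvalues other than the constant row sum have coordinate sum zero. -/
theorem sum_eq_zero_of_mulVec_eq_smul {k x : ℝ} {y : V → ℝ}
    (hrow : ∀ u, ∑ v, G.symmetricDigraph.realAdj u v = k)
    (h : G.symmetricDigraph.realAdj.mulVec y = x • y) (hx : x ≠ k) : ∑ v, y v = 0 := by
  have h1 : ∑ u, G.symmetricDigraph.realAdj.mulVec y u = k * ∑ v, y v := by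
    simp only [Matrix.mulVec, dotProduct]
    rw [Finset.sum_comm]
    simp only [← Finset.sum_mul]
    rw [Finset.mul_sum]
    refine Finset.sum_congr rfl fun v _ => ?_
    rw [← hrow v]
    congr 1
    exact Finset.sum_congr rfl fun u _ => G.realAdj_symmetricDigraph_comm u v
  rw [h] at h1
  simp only [Pi.smul_apply, smul_eq_mul, ← Finset.mul_sum] at h1
  have : (x - k) * ∑ v, y v = 0 := by linarith
  exact (mul_eq_zero.mp this).resolve_left (sub_ne_zero.mpr hx)

/-- The two non-trivial eigenvalues are opposite roots of `z² = (l-m) z + (k-m)`, so `l = m` and `A²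
= x² I + m J`. -/
theorem energy_eq_of_isConnectedSRGWithNontrivialAbs [Nonempty V] {θ : ℝ}
    (h : G.IsConnectedSRGWithNontrivialAbs θ) :
    G.symmetricDigraph.energy = √G.symmetricDigraph.walkQuotient +
      √(((Fintype.card V : ℝ) - 1) *
        ((G.symmetricDigraph.numArcs : ℝ) - G.symmetricDigraph.walkQuotient)) := by
  obtain ⟨-, -, k, l, m, hsrg, x, y, hxy, hspec, hx, hy⟩ := h
  have hrow : ∀ u, ∑ v, G.symmetricDigraph.realAdj u v = (k : ℝ) := by
    intro u
    have := hsrg.regular u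
    rw [← this]
    simp only [realAdj_symmetricDigraph_apply, Finset.sum_boole, ← card_neighborFinset_eq_degree,
      neighborFinset_eq_filter]
  have hsq : ∀ u v, (G.symmetricDigraph.realAdj * G.symmetricDigraph.realAdj) u v =
      ((l : ℝ) - m) * G.symmetricDigraph.realAdj u v + (if u = v then (k : ℝ) - m else 0) + m := by
    intro u v
    have h1 := congrFun (congrFun (hsrg.matrix_eq (α := ℝ)) u) v
    rw [adjMatrix_eq_realAdj, pow_two] at h1
    rw [h1, realAdj_symmetricDigraph_apply]
    simp only [Matrix.add_apply, Matrix.smul_apply, realAdj_symmetricDigraph_apply,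
      adjMatrix_apply, compl_adj, Matrix.one_apply]
    by_cases huv : u = v
    · subst huv; simp
    · by_cases ha : G.Adj u v <;> simp [huv, ha]
  have hquad : ∀ z ∈ ({x, y} : Set ℝ), z ^ 2 = ((l : ℝ) - m) * z + (k - m) := by
    intro z hz
    rw [← hspec, adjMatrix_eq_realAdj] at hz
    obtain ⟨w, hw, hAw⟩ := Matrix.exists_mulVec_eq_smul_of_mem_spectrum hz.1
    have hsum := G.sum_eq_zero_of_mulVec_eq_smul hrow hAw hz.2
    obtain ⟨u, hu⟩ := Function.ne_iff.mp hw
    refine mul_right_cancel₀ (b := w u) hu ?_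
    have h1 : ((G.symmetricDigraph.realAdj * G.symmetricDigraph.realAdj).mulVec w) u =
        z ^ 2 * w u := by
      rw [← Matrix.mulVec_mulVec, hAw, Matrix.mulVec_smul, hAw]
      simp [sq, mul_assoc]
    have h2 : ∑ v, G.symmetricDigraph.realAdj u v * w v = z * w u := congrFun hAw u
    rw [← h1, Matrix.mulVec, dotProduct]
    simp only [hsq, add_mul, Finset.sum_add_distrib, mul_assoc, ← Finset.mul_sum, h2, hsum]
    simp
  have hyx : y = -x := by
    rcases (abs_eq_abs.mp (hx.trans hy.symm)) with h1 | h1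
    · exact absurd h1 hxy
    · linarith
  have hx0 : x ≠ 0 := by
    rintro rfl
    exact hxy (by simp [hyx])
  have q1 := hquad x (by simp)
  have q2 := hquad (-x) (by simp [hyx])
  have hlm : (l : ℝ) - m = 0 := by
    have : ((l : ℝ) - m) * x = 0 := by linarith [neg_sq x]
    exact (mul_eq_zero.mp this).resolve_right hx0
  refine G.energy_eq_of_mul_self_eq (k := k) (θ := |x|) (μ := m) (abs_nonneg x) hrow ?_
  intro u v
  rw [hsq, hlm, sq_abs, q1, hlm]
  simp

end SimpleGraph

/-! ### Digraphs of zero energy -/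

namespace Digraph

variable {V : Type*} [Fintype V] (D : Digraph V)

theorem energy_eq_zero_of_mul_self_eq_zero (h : D.adjacencyMatrix * D.adjacencyMatrix = 0) :
    D.energy = 0 := by
  classical
  refine Multiset.sum_eq_zero fun x hx => ?_
  obtain ⟨z, hz, rfl⟩ := Multiset.mem_map.mp hx
  have hz1 := (Polynomial.mem_roots'.mp hz).2
  rw [← Matrix.charpoly_toLin', ← Module.End.hasEigenvalue_iff_isRoot_charpoly] at hz1
  obtain ⟨w, hw⟩ := hz1.exists_hasEigenvector
  have h1 : D.adjacencyMatrix.mulVec w = z • w := by simpa using hw.apply_eq_smul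
  have h2 : z • z • w = 0 := by
    rw [← h1, ← Matrix.mulVec_smul, ← h1, Matrix.mulVec_mulVec, h, Matrix.zero_mulVec]
  have hz0 : z = 0 := by
    rcases smul_eq_zero.mp h2 with h3 | h3
    · exact h3
    · exact (smul_eq_zero.mp h3).resolve_right hw.2
  simp [hz0]

theorem not_adj_of_numArcs_eq_zero (h : D.numArcs = 0) (u v : V) : ¬ D.Adj u v := by
  intro huv
  classical
  rw [numArcs, Finset.card_eq_zero, Finset.filter_eq_empty_iff] at h
  exact h (Finset.mem_univ (u, v)) huv

theorem not_adj_swap_of_sum_closedTwoWalks_eq_zero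
    (h : ∑ v, (D.closedTwoWalks v : ℝ) = 0) {u v : V} (huv : D.Adj u v) : ¬ D.Adj v u := by
  intro hvu
  have h1 := (Finset.sum_eq_zero_iff_of_nonneg fun v _ => Nat.cast_nonneg _).mp h u
    (Finset.mem_univ u)
  rw [Nat.cast_eq_zero, closedTwoWalks, Finset.card_eq_zero] at h1
  refine Finset.notMem_empty v (h1 ▸ ?_)
  simp [doublyAdjacent, huv, hvu]

/-- A digraph on two vertices without loops and closed walks of length `2` has no energy. -/
theorem energy_eq_zero_of_card_eq_two (hD : ∀ v, ¬ D.Adj v v)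
    (h : ∑ v, (D.closedTwoWalks v : ℝ) = 0) (hn : Fintype.card V = 2) : D.energy = 0 := by
  classical
  refine D.energy_eq_zero_of_mul_self_eq_zero ?_
  ext u v
  rw [Matrix.mul_apply]
  refine Finset.sum_eq_zero fun w _ => ?_
  rw [adjacencyMatrix_eq_map, Matrix.map_apply, Matrix.map_apply, realAdj_apply, realAdj_apply]
  by_cases h1 : D.Adj u w
  · by_cases h2 : D.Adj w v
    · exfalso
      have huw : u ≠ w := by rintro rfl; exact hD _ h1
      have hwv : w ≠ v := by rintro rfl; exact hD _ h2
      have huv : u ≠ v := by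
        rintro rfl
        exact D.not_adj_swap_of_sum_closedTwoWalks_eq_zero h h1 h2
      have : ({u, w, v} : Finset V).card ≤ Fintype.card V := Finset.card_le_univ _
      rw [Finset.card_eq_three.mpr ⟨u, w, v, huw, huv, hwv, rfl⟩] at this
      omega
    · simp [h2]
  · simp [h1]

end Digraph

/-! ### Graphs determined by the square of the adjacency matrix -/

namespace SimpleGraph

open Classical

variable {V : Type*} [Fintype V] (G : SimpleGraph V)

/-- If the square of the adjacency matrix is a scalar plus a positive multiple of `c cᵀ`, `c` the
vector of degrees, then the graph is regular. -/
theorem regular_of_mul_self_eq {r β : ℝ} (hβ : 0 < β) {c : V → ℝ}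
    (hc : ∀ u, ∑ v, G.symmetricDigraph.realAdj u v = c u) (hc0 : c ≠ 0)
    (hsq : ∀ u v, (G.symmetricDigraph.realAdj * G.symmetricDigraph.realAdj) u v =
      (if u = v then r else 0) + β * (c u * c v)) :
    r ≠ 0 ∧ ∃ k, ∀ u, c u = k := by
  obtain ⟨u₀, hu₀⟩ := Function.ne_iff.mp hc0
  change c u₀ ≠ 0 at hu₀
  have hcomm := G.realAdj_symmetricDigraph_comm
  have hdiag := G.realAdj_self
  set A := G.symmetricDigraph.realAdj
  -- If `r = 0`, the rows of `A` are proportional. Comparing rows `u₀` and `v` in column `u₀`, where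
  -- `A` has a zero diagonal entry, leaves `u₀` isolated.
  have hr : r ≠ 0 := by
    rintro rfl
    have hsq' : ∀ u v, ∑ w, A u w * A v w = β * (c u * c v) := by
      intro u v
      have h1 := hsq u v
      rw [Matrix.mul_apply] at h1
      simp only [ite_self, zero_add] at h1
      rw [← h1]
      exact Finset.sum_congr rfl fun w _ => by rw [hcomm v w]
    refine hu₀ ?_
    rw [← hc]
    refine Finset.sum_eq_zero fun v _ => ?_
    have hz : ∑ w, (c v * A u₀ w - c u₀ * A v w) ^ 2 = 0 := by
      have h1 : ∀ w, (c v * A u₀ w - c u₀ * A v w) ^ 2 = c v ^ 2 * (A u₀ w * A u₀ w) -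
          2 * (c u₀ * c v) * (A u₀ w * A v w) + c u₀ ^ 2 * (A v w * A v w) := fun w => by ring
      simp only [h1, Finset.sum_add_distrib, Finset.sum_sub_distrib, ← Finset.mul_sum, hsq']
      ring
    have h1 := (Finset.sum_eq_zero_iff_of_nonneg fun i _ => sq_nonneg _).mp hz u₀
      (Finset.mem_univ u₀)
    have h2 := pow_eq_zero_iff two_ne_zero |>.mp h1
    rw [hdiag, mul_zero, zero_sub, neg_eq_zero] at h2
    rw [hcomm]
    exact (mul_eq_zero.mp h2).resolve_left hu₀
  refine ⟨hr, ?_⟩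
  -- `A` commutes with `A²`, so `(A c) cᵀ = c (A c)ᵀ` and `A c` is a multiple of `c`.
  have hy : ∀ u v, A.mulVec c u * c v = c u * A.mulVec c v := by
    intro u v
    have h1 : (A * (A * A)) u v = ((A * A) * A) u v := by rw [Matrix.mul_assoc]
    rw [Matrix.mul_apply, Matrix.mul_apply] at h1
    simp only [hsq, mul_add, add_mul, Finset.sum_add_distrib, mul_ite, ite_mul, mul_zero, zero_mul,
      Finset.sum_ite_eq, Finset.sum_ite_eq', Finset.mem_univ, if_true] at h1
    have h2 : ∑ w, A u w * (β * (c w * c v)) = β * (A.mulVec c u * c v) := by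
      rw [Matrix.mulVec, dotProduct, Finset.sum_mul, Finset.mul_sum]
      exact Finset.sum_congr rfl fun w _ => by ring
    have h3 : ∑ w, β * (c u * c w) * A w v = β * (c u * A.mulVec c v) := by
      rw [Matrix.mulVec, dotProduct, Finset.mul_sum, Finset.mul_sum]
      exact Finset.sum_congr rfl fun w _ => by rw [hcomm w v]; ring
    rw [h2, h3] at h1
    refine mul_left_cancel₀ hβ.ne' ?_
    linarith
  have hγ : ∀ u, A.mulVec c u = A.mulVec c u₀ / c u₀ * c u := by
    intro u
    have := hy u u₀
    field_simp
    linarith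
  -- Applying `A²` to the all-ones vector gives `A c`. Together with `A c ∥ c` this makes a multiple
  -- of `c` equal to the nonzero constant `r`.
  have hsum : ∀ u, A.mulVec c u = r + β * (∑ v, c v) * c u := by
    intro u
    have h1 : ∑ v, (A * A) u v = A.mulVec c u := by
      simp only [Matrix.mul_apply, Matrix.mulVec, dotProduct]
      rw [Finset.sum_comm]
      simp only [← Finset.mul_sum, hc]
    rw [← h1]
    simp only [hsq, Finset.sum_add_distrib, Finset.sum_ite_eq, Finset.mem_univ, if_true,
      ← Finset.mul_sum]
    ring
  set δ := A.mulVec c u₀ / c u₀ - β * ∑ v, c v with hδ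
  have hrδ : ∀ u, δ * c u = r := by
    intro u
    have h1 := hsum u
    rw [hγ] at h1
    rw [hδ]
    linarith
  have hδ0 : δ ≠ 0 := by
    intro h0
    exact hr (by rw [← hrδ u₀, h0, zero_mul])
  refine ⟨r / δ, fun u => ?_⟩
  rw [← hrδ u]
  field_simp

theorem card_commonNeighbors_eq (u v : V) : (Fintype.card (G.commonNeighbors u v) : ℝ) =
    (G.symmetricDigraph.realAdj * G.symmetricDigraph.realAdj) u v := by
  rw [mul_self_realAdj_apply, Finset.sum_boole, ← Set.toFinset_card]
  congr 2
  ext w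
  simp [mem_commonNeighbors]

/-- Since `A (A + τ) = τ (A + τ) + μ J`, each column of `A + τ` is a `τ`-eigenvector up to a
constant shift, and `μ/(k-τ)` is the shift that cancels `μ J`. -/
theorem mulVec_column_eq {k μ τ : ℝ}
    (hrow : ∀ u, ∑ v, G.symmetricDigraph.realAdj u v = k)
    (hsq : ∀ u v, (G.symmetricDigraph.realAdj * G.symmetricDigraph.realAdj) u v =
      (if u = v then τ ^ 2 else 0) + μ) (hτ : τ ≠ k) (v : V) :
    G.symmetricDigraph.realAdj.mulVec (fun u => G.symmetricDigraph.realAdj u v +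
      (if u = v then τ else 0) - μ / (k - τ)) =
    τ • fun u => G.symmetricDigraph.realAdj u v + (if u = v then τ else 0) - μ / (k - τ) := by
  ext u
  have h1 := hsq u v
  rw [Matrix.mul_apply] at h1
  simp only [Matrix.mulVec, dotProduct, mul_sub, mul_add, Finset.sum_sub_distrib,
    Finset.sum_add_distrib, h1, ← Finset.sum_mul, hrow, mul_ite, mul_zero, Finset.sum_ite_eq',
    Finset.mem_univ, if_true, Pi.smul_apply, smul_eq_mul]
  have : k - τ ≠ 0 := sub_ne_zero.mpr hτ.symm
  by_cases huv : u = v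
  · subst huv
    simp only [if_true]
    field_simp
    ring
  · simp only [huv, if_false]
    field_simp
    ring

/-- A non-complete regular graph the square of whose adjacency matrix is `θ²` plus a positive
multiple of the all-ones matrix is strongly regular with non-trivial eigenvalues `θ` and `-θ`. -/
theorem isConnectedSRGWithNontrivialAbs_of_mul_self_eq [Nontrivial V] {k θ μ : ℝ} (hG : G ≠ ⊤)
    (hθ : 0 < θ) (hμ : 0 < μ) (hrow : ∀ u, ∑ v, G.symmetricDigraph.realAdj u v = k)
    (hsq : ∀ u v, (G.symmetricDigraph.realAdj * G.symmetricDigraph.realAdj) u v =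
      (if u = v then θ ^ 2 else 0) + μ) : G.IsConnectedSRGWithNontrivialAbs θ := by
  obtain ⟨u₀, v₀, huv₀⟩ := exists_pair_ne V
  have hdeg : ∀ u, (G.degree u : ℝ) = k := by
    intro u
    rw [← hrow u]
    simp only [realAdj_symmetricDigraph_apply, Finset.sum_boole, ← card_neighborFinset_eq_degree,
      neighborFinset_eq_filter]
  have hk0 : 0 ≤ k := by rw [← hdeg u₀]; exact Nat.cast_nonneg _
  have hksq : k ^ 2 = θ ^ 2 + Fintype.card V * μ := by
    have h1 : ∑ v, (G.symmetricDigraph.realAdj * G.symmetricDigraph.realAdj) u₀ v = k ^ 2 := by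
      simp only [Matrix.mul_apply]
      rw [Finset.sum_comm]
      simp only [← Finset.mul_sum, hrow, ← Finset.sum_mul, sq]
    rw [← h1]
    simp [hsq, Finset.sum_add_distrib]
  have hn : (0 : ℝ) < Fintype.card V := by exact_mod_cast Fintype.card_pos
  have hθk : θ < k := by
    refine lt_of_pow_lt_pow_left₀ 2 hk0 ?_
    nlinarith [mul_pos hn hμ]
  have hcard : ∀ u v, u ≠ v → (Fintype.card (G.commonNeighbors u v) : ℝ) = μ := by
    intro u v huv
    rw [card_commonNeighbors_eq, hsq, if_neg huv, zero_add]
  have hcard' : ∀ u v, u ≠ v →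
      Fintype.card (G.commonNeighbors u v) = Fintype.card (G.commonNeighbors u₀ v₀) := by
    intro u v huv
    have := (hcard u v huv).trans (hcard u₀ v₀ huv₀).symm
    exact_mod_cast this
  have hpos : θ ∈ spectrum ℝ G.symmetricDigraph.realAdj := by
    by_contra hnot
    refine hG ?_
    -- If `θ` is not an eigenvalue, all shifted columns vanish. The diagonal gives `μ/(k-θ) = θ >
    -- 0`, so no off-diagonal entry of `A` is zero.
    have hy : ∀ u v, G.symmetricDigraph.realAdj u v + (if u = v then θ else 0) -
        μ / (k - θ) = 0 := by
      intro u v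
      by_contra hne
      exact hnot (Matrix.mem_spectrum_of_mulVec_eq_smul (fun h => hne (congrFun h u))
        (G.mulVec_column_eq hrow hsq hθk.ne v))
    ext u v
    rw [top_adj]
    refine ⟨fun h => h.ne, fun huv => ?_⟩
    have h1 := hy u u
    have h2 := hy u v
    rw [realAdj_self, if_pos rfl] at h1
    rw [if_neg huv, realAdj_symmetricDigraph_apply] at h2
    by_contra hadj
    rw [if_neg hadj] at h2
    linarith
  have hneg : -θ ∈ spectrum ℝ G.symmetricDigraph.realAdj := by
    by_contra hnot
    have hne : -θ ≠ k := by linarith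
    have hsq' : ∀ u v, (G.symmetricDigraph.realAdj * G.symmetricDigraph.realAdj) u v =
        (if u = v then (-θ) ^ 2 else 0) + μ := by simpa only [neg_sq] using hsq
    -- For `τ = -θ` a vanishing diagonal entry would equate `-θ` with the positive number `μ/(k+θ)`.
    have h1 : G.symmetricDigraph.realAdj u₀ u₀ + (if u₀ = u₀ then -θ else 0) -
        μ / (k - -θ) = 0 := by
      by_contra hne'
      exact hnot (Matrix.mem_spectrum_of_mulVec_eq_smul (fun h => hne' (congrFun h u₀))
        (G.mulVec_column_eq hrow hsq' hne u₀))
    rw [realAdj_self, if_pos rfl] at h1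
    have : 0 < μ / (k - -θ) := div_pos hμ (by linarith)
    linarith
  refine ⟨hG, ?_, G.degree u₀, Fintype.card (G.commonNeighbors u₀ v₀),
    Fintype.card (G.commonNeighbors u₀ v₀), ⟨rfl, ?_, ?_, ?_⟩, θ, -θ, by linarith, ?_,
    abs_of_pos hθ, by rw [abs_neg, abs_of_pos hθ]⟩
  · refine Connected.mk fun u v => ?_
    by_cases huv : u = v
    · rw [huv]
    have h1 : (0 : ℝ) < Fintype.card (G.commonNeighbors u v) := by rw [hcard u v huv]; exact hμ
    obtain ⟨w, hw⟩ := Fintype.card_pos_iff.mp (Nat.cast_pos.mp h1)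
    rw [mem_commonNeighbors] at hw
    exact hw.1.reachable.trans hw.2.symm.reachable
  · intro u
    have := (hdeg u).trans (hdeg u₀).symm
    exact_mod_cast this
  · intro u v huv
    exact hcard' u v huv.ne
  · intro u v huv _
    exact hcard' u v huv
  · rw [adjMatrix_eq_realAdj, hdeg]
    ext z
    simp only [Set.mem_sdiff, Set.mem_singleton_iff, Set.mem_insert_iff]
    constructor
    · rintro ⟨hz, hzk⟩
      obtain ⟨w, hw, hAw⟩ := Matrix.exists_mulVec_eq_smul_of_mem_spectrum hz
      have hsum := G.sum_eq_zero_of_mulVec_eq_smul hrow hAw hzk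
      obtain ⟨u, hu⟩ := Function.ne_iff.mp hw
      have h1 : ((G.symmetricDigraph.realAdj * G.symmetricDigraph.realAdj).mulVec w) u =
          z ^ 2 * w u := by
        rw [← Matrix.mulVec_mulVec, hAw, Matrix.mulVec_smul, hAw]
        simp [sq, mul_assoc]
      rw [Matrix.mulVec, dotProduct] at h1
      simp only [hsq, add_mul, Finset.sum_add_distrib, ← Finset.mul_sum, hsum, ite_mul, zero_mul,
        Finset.sum_ite_eq, Finset.mem_univ, if_true, mul_zero, add_zero] at h1
      exact sq_eq_sq_iff_eq_or_eq_neg.mp (mul_right_cancel₀ hu h1).symm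
    · rintro (rfl | rfl)
      · exact ⟨hpos, hθk.ne⟩
      · exact ⟨hneg, by linarith⟩

/-- A nonzero diagonal of `A²` excludes isolated vertices, and zero off-diagonal entries exclude two
neighbours of the same vertex. -/
theorem isHalfCopiesK2_of_mul_self_eq {r : ℝ} (hr : r ≠ 0)
    (hsq : ∀ u v, (G.symmetricDigraph.realAdj * G.symmetricDigraph.realAdj) u v =
      if u = v then r else 0) : G.IsHalfCopiesK2 := by
  have hex : ∀ u, ∃ v, G.Adj u v := by
    intro u
    by_contra! h
    have h1 := hsq u u
    rw [mul_self_realAdj_apply, if_pos rfl] at h1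
    exact hr (by rw [← h1]; simp [h])
  choose f hf using hex
  refine IsHalfCopiesK2.of_adj_iff G (f := f) fun u v => ⟨fun huv => ?_, fun h => h ▸ hf u⟩
  by_contra hne
  have h1 := hsq v (f u)
  rw [mul_self_realAdj_apply, if_neg hne,
    Finset.sum_eq_zero_iff_of_nonneg fun w _ => by split_ifs <;> norm_num] at h1
  have := h1 u (Finset.mem_univ u)
  rw [if_pos ⟨huv.symm, (hf u).symm⟩] at this
  exact one_ne_zero this

end SimpleGraph

/-! ### Digraphs without arcs -/

namespace Digraph

variable {V : Type*} [Fintype V] (D : Digraph V)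

/-- A digraph without arcs attains the energy bound. -/
theorem energy_eq_of_numArcs_eq_zero (h : D.numArcs = 0) :
    D.walkQuotient = 0 ∧ D.energy = √D.walkQuotient +
      √(((Fintype.card V : ℝ) - 1) * ((D.numArcs : ℝ) - D.walkQuotient)) := by
  have hadj := D.not_adj_of_numArcs_eq_zero h
  have hq : D.walkQuotient = 0 :=
    D.walkQuotient_eq_zero fun v => by simp [closedTwoWalks, doublyAdjacent, hadj]
  refine ⟨hq, ?_⟩
  rw [hq, h, D.energy_eq_zero_of_mul_self_eq_zero]
  · simp
  · have : D.adjacencyMatrix = 0 := by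
      ext u v
      simp [adjacencyMatrix, hadj]
    rw [this, Matrix.zero_mul]

theorem eq_symmetricDigraph_bot_of_numArcs_eq_zero (h : D.numArcs = 0) :
    D = (⊥ : SimpleGraph V).symmetricDigraph := by
  ext u v
  exact iff_of_false (D.not_adj_of_numArcs_eq_zero h u v) id

theorem one_lt_card_of_numArcs_ne_zero (hD : ∀ v, ¬ D.Adj v v) (h : D.numArcs ≠ 0) :
    1 < Fintype.card V := by
  classical
  rw [numArcs, Finset.card_ne_zero] at h
  obtain ⟨p, hp⟩ := h
  refine Fintype.one_lt_card_iff.mpr ⟨p.1, p.2, fun hpp => hD p.1 ?_⟩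
  have := (Finset.mem_filter.mp hp).2
  rwa [← hpp] at this

theorem numArcs_symmetricDigraph_bot : (⊥ : SimpleGraph V).symmetricDigraph.numArcs = 0 := by
  classical
  rw [numArcs, Finset.card_eq_zero, Finset.filter_eq_empty_iff]
  exact fun _ _ h => h

end Digraph

/-! ### The equality cases and the final assembly -/

namespace SimpleGraph

variable {V : Type*} [Fintype V] (G : SimpleGraph V)

/-- The graphs whose symmetric digraph satisfies the spectral equality conditions. -/
theorem equality_cases_of_sq_eigenvalues [DecidableEq V] (hn : 1 < Fintype.card V)
    (h0 : G.symmetricDigraph.numArcs ≠ 0)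
    (ha : (G.symmetricDigraph.numArcs : ℝ) ≤
      Fintype.card V * G.symmetricDigraph.walkQuotient) {r : ℝ}
    (hr : r = ((G.symmetricDigraph.numArcs : ℝ) - G.symmetricDigraph.walkQuotient) /
      ((Fintype.card V : ℝ) - 1)) (hq : G.symmetricDigraph.walkQuotient ≤
      G.symmetricDigraph.numArcs) {k₀ : V}
    (hk₀ : G.symmetricDigraph.isHermitian_symmPart.eigenvalues k₀ ^ 2 =
      G.symmetricDigraph.walkQuotient)
    (hk : ∀ k, k ≠ k₀ → G.symmetricDigraph.isHermitian_symmPart.eigenvalues k ^ 2 = r) :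
    G.IsHalfCopiesK2 ∨ G = ⊤ ∨ G.IsConnectedSRGWithNontrivialAbs √r := by
  have : Nontrivial V := Fintype.one_lt_card_iff_nontrivial.mp hn
  have hN : (0 : ℝ) < (Fintype.card V : ℝ) - 1 := by
    have : (1 : ℝ) < Fintype.card V := by exact_mod_cast hn
    linarith
  have hr0 : 0 ≤ r := by rw [hr]; exact div_nonneg (by linarith) hN.le
  have hrq : r ≤ G.symmetricDigraph.walkQuotient := by
    rw [hr, div_le_iff₀ hN]
    linarith
  set c : V → ℝ := fun v => (G.symmetricDigraph.closedTwoWalks v : ℝ) with hcdef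
  have hc : ∀ u, ∑ v, G.symmetricDigraph.realAdj u v = c u :=
    fun u => (G.closedTwoWalks_symmetricDigraph u).symm
  obtain ⟨v, hv⟩ : ∃ v, G.symmetricDigraph.closedTwoWalks v ≠ 0 := by
    by_contra! h
    have h1 := G.symmetricDigraph.sum_realAdj
    simp only [hc, hcdef, h] at h1
    simp only [Nat.cast_zero, Finset.sum_const_zero] at h1
    exact h0 (by exact_mod_cast h1.symm)
  have hc0 : c ≠ 0 := fun h => hv (Nat.cast_eq_zero.mp (congrFun h v))
  have hsq := G.symmetricDigraph.isHermitian_symmPart.mul_self_eq_of_sq_eigenvalues hk₀ hk hc0 (by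
    rw [G.symmetricDigraph.walkQuotient_mul hv, symmPart_symmetricDigraph]
    exact Finset.sum_congr rfl fun u _ => by rw [twoWalkSum_symmetricDigraph]; rfl)
  rw [symmPart_symmetricDigraph] at hsq
  have hpos : 0 < ∑ i, c i ^ 2 := G.symmetricDigraph.sum_sq_closedTwoWalks_pos hv
  -- The coefficient of `c cᵀ` is zero or positive according to whether `r = q` or `r < q`.
  rcases hrq.eq_or_lt with hqr | hqr
  · left
    simp only [← hqr, sub_self, zero_div, zero_mul, add_zero] at hsq
    refine G.isHalfCopiesK2_of_mul_self_eq (r := r) ?_ fun u v => by rw [hsq]; congr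
    have := G.symmetricDigraph.one_le_walkQuotient hv
    linarith
  · right
    have hβ : 0 < (G.symmetricDigraph.walkQuotient - r) / ∑ i, c i ^ 2 :=
      div_pos (by linarith) hpos
    obtain ⟨hr1, k, hck⟩ := G.regular_of_mul_self_eq hβ hc hc0 (r := r)
      fun u v => by rw [hsq]; congr
    have hk0 : k ≠ 0 := by
      rintro rfl
      exact hc0 (funext hck)
    by_cases hG : G = ⊤
    · exact Or.inl hG
    refine Or.inr (G.isConnectedSRGWithNontrivialAbs_of_mul_self_eq
      (k := k) (μ := (G.symmetricDigraph.walkQuotient - r) / (∑ i, c i ^ 2) * (k * k)) hG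
      (Real.sqrt_pos.mpr (lt_of_le_of_ne hr0 hr1.symm))
      (mul_pos hβ (mul_self_pos.mpr hk0)) (fun u => (hc u).trans (hck u)) fun u v => ?_)
    rw [hsq, Real.sq_sqrt hr0, hck, hck]
    congr

end SimpleGraph

theorem mainTheorem2 {V : Type*} [Fintype V] (D : Digraph V) (hD : ∀ v, ¬ D.Adj v v) :
    D.walkQuotient ≤ D.numArcs ∧
    D.energy ≤ √D.walkQuotient +
      √(((Fintype.card V : ℝ) - 1) * ((D.numArcs : ℝ) - D.walkQuotient)) ∧
    (D.energy = √D.walkQuotient +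
        √(((Fintype.card V : ℝ) - 1) * ((D.numArcs : ℝ) - D.walkQuotient)) ↔
      ∃ G : SimpleGraph V, D = G.symmetricDigraph ∧
        (G.IsHalfCopiesK2 ∨ G = ⊤ ∨ G = ⊥ ∨
          G.IsConnectedSRGWithNontrivialAbs
            √(((D.numArcs : ℝ) - D.walkQuotient) / ((Fintype.card V : ℝ) - 1)))) := by
  classical
  -- Without loops, fewer than two vertices means no arcs, so this case also absorbs `n ≤ 1`, where
  -- `n - 1` is not positive.
  by_cases h0 : D.numArcs = 0
  · obtain ⟨hq, hE⟩ := D.energy_eq_of_numArcs_eq_zero h0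
    refine ⟨by rw [hq]; positivity, hE.le, fun _ => ?_, fun _ => hE⟩
    exact ⟨⊥, D.eq_symmetricDigraph_bot_of_numArcs_eq_zero h0, Or.inr (Or.inr (Or.inl rfl))⟩
  have hn := D.one_lt_card_of_numArcs_ne_zero hD h0
  have hne : Nonempty V := Fintype.card_pos_iff.mp (by omega)
  obtain ⟨h1, h2, h3⟩ := D.energy_bound hn
  refine ⟨h1, h2, fun h => ?_, ?_⟩
  · rcases h3 h with ⟨hC, hor⟩ | ⟨hC, ha, k₀, hk₀, hk⟩
    -- On two vertices without closed 2-walks the energy and `q` are zero, whereas the bound is `√a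
    -- > 0`.
    · exfalso
      have hn2 := hor.resolve_left h0
      rw [D.energy_eq_zero_of_card_eq_two hD hC hn2, hn2, D.walkQuotient_eq_zero] at h
      · have h4 : (0 : ℝ) < D.numArcs := by exact_mod_cast Nat.pos_of_ne_zero h0
        norm_num at h
        exact absurd h.symm (Real.sqrt_pos.mpr h4).ne'
      · intro v
        have := (Finset.sum_eq_zero_iff_of_nonneg fun v _ => Nat.cast_nonneg _).mp hC v
          (Finset.mem_univ v)
        exact_mod_cast this
    · have hsymm := fun u v => D.adj_symm_of_sum_closedTwoWalks_eq hC (u := u) (v := v)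
      let G : SimpleGraph V := { Adj := D.Adj, symm := ⟨hsymm⟩, loopless := ⟨hD⟩ }
      have hDG : D = G.symmetricDigraph := rfl
      refine ⟨G, hDG, ?_⟩
      rcases G.equality_cases_of_sq_eigenvalues hn h0 ha rfl h1 hk₀ hk with h5 | h5 | h5
      · exact Or.inl h5
      · exact Or.inr (Or.inl h5)
      · exact Or.inr (Or.inr (Or.inr h5))
  · rintro ⟨G, rfl, hG | rfl | rfl | hG⟩
    · exact G.energy_eq_of_isHalfCopiesK2 hG
    · exact SimpleGraph.energy_eq_of_top
    · exact absurd Digraph.numArcs_symmetricDigraph_bot h0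
    · exact G.energy_eq_of_isConnectedSRGWithNontrivialAbs hG
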